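/- Let $p$ be a prime and let $R$ be a regular domain of characteristic $p$ that is $F$-finite (the Frobenius $R\to R$, $u\mapsto u^p$, is finite). Let $f\in R$ be nonzero. For an ideal $J$ let $J^{[p^k]}$ be the ideal generated by the $u^{p^k}$, $u\in J$; for an ideal $\mathfrak b$ let $\mathfrak b^{[1/p^k]}$ be the smallest ideal $J$ with $\mathfrak b\subseteq J^{[p^k]}$. For a real $\lambda\ge 0$ let $\tau(f^\lambda)=\big((f)^{\lceil \lambda p^k\rceil}\big)^{[1/p^k]}$ for $k\gg 0$ (the test ideal). A real $\lambda>0$ is an $F$-jumping exponent of $f$ if $\tau(f^{\lambda})\ne\tau(f^{\lambda'})$ for all $0\le\lambda'<\lambda$; by convention $0$ is one too. Let $D_R$ be the ring of all differential operators of $R$, and $D_R^{k}=\mathrm{End}_{R^{p^k}}(R)$, so that $D_R=\bigcup_k D_R^k$. Let $e,r$ be positive integers and $\alpha=\frac{r}{p^e-1}$. Let $M_\alpha$ be the free $R_f$-module of rank one with generator $e_\alpha$, with the additive map $F^e\colon M_\alpha\to M_\alpha$, $$F^e\Big(\frac{b}{f^n}\,e_\alpha\Big)=\frac{b^{p^e}}{f^{np^e+r}}\,e_\alpha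 .$$ For every $s\ge 0$, let $R^{se}$ be $R$ with right $R$-module structure through the $se$-th iterate of Frobenius. The map $\theta^{se}\colon R^{se}\otimes_R M_\alpha\to M_\alpha$, $a\otimes u\mapsto a\,(F^e)^s(u)$, is an isomorphism, and $M_\alpha$ is the $D_R$-module on which $P\in D_R^{se}$ acts by transporting $a\otimes u\mapsto P(a)\otimes u$ through $\theta^{se}$. For $m\ge 0$ put $\alpha_m=\frac{p^{me}-1}{p^{me}}\,\alpha$. Then: 1. $e_\alpha$ generates $M_\alpha$ as a $D_R$-module if and only if $\alpha$ is not an accumulation point of the set of $F$-jumping exponents of $f$. 2. For every integer $m\ge 0$, one has $\tau(f^{\alpha_m})=\tau(f^{\alpha_{m+1}})$ if and only if there is $P\in D_R^{(m+1)e}$ such that $P\cdot e_\alpha=F^e(e_\alpha)$. -/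

import Mathlib

open Filter Topology
open scoped TensorProduct

namespace FThreshold

/-! ### Test ideals and `F`-jumping exponents -/

section TestIdeals

variable {R : Type*} [CommRing R]

/-- The Frobenius power `J^{[p^e]}`: the ideal generated by all `u ^ (p ^ e)` with `u ∈ J`. -/
def frobPower (p e : ℕ) (J : Ideal R) : Ideal R :=
  Ideal.span ((fun u : R => u ^ p ^ e) '' (J : Set R))

/-- The ideal `𝔟^{[1/p^e]}`: the smallest ideal `J` with `𝔟 ⊆ J^{[p^e]}`. (In a regular
`F`-finite ring such a smallest ideal exists, so that it is the intersection of all such `J`.) -/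
def frobRoot (p e : ℕ) (b : Ideal R) : Ideal R :=
  sInf {J : Ideal R | b ≤ frobPower p e J}

/-- The test ideal `τ(𝔞^l)` for a real number `l ≥ 0`.  The ideals
`(𝔞^{⌈l p^e⌉})^{[1/p^e]}` form an ascending chain in `e` if `R` is regular and `F`-finite, so that their common value for
`e ≫ 0` is their supremum. -/
noncomputable def testIdeal (p : ℕ) (a : Ideal R) (l : ℝ) : Ideal R :=
  ⨆ e : ℕ, frobRoot p e (a ^ ⌈l * (p : ℝ) ^ e⌉₊)

/-- `l` is an `F`-jumping exponent of `𝔞`: either `l > 0` and `τ(𝔞^l) ≠ τ(𝔞^{l'})` for all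
`0 ≤ l' < l`, or `l = 0` (by convention). -/
def IsFJumpingExponent (p : ℕ) (a : Ideal R) (l : ℝ) : Prop :=
  l = 0 ∨ (0 < l ∧ ∀ l' : ℝ, 0 ≤ l' → l' < l → testIdeal p a l ≠ testIdeal p a l')

end TestIdeals

/-! ### Differential operators -/

section DiffOps

/-- `IsDiffOp n P`: the additive endomorphism `P` of `R` is a differential operator of
order `< n` (in the sense of Grothendieck). -/
def IsDiffOp {R : Type*} [CommRing R] : ℕ → Module.End ℤ R → Prop
  | 0, P => P = 0
  | n + 1, P => ∀ a : R,
      IsDiffOp n (P * LinearMap.mulLeft ℤ a - LinearMap.mulLeft ℤ a * P)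

variable {R : Type*} [CommRing R]

theorem IsDiffOp.zero (n : ℕ) : IsDiffOp n (0 : Module.End ℤ R) := by
  induction n with
  | zero => rfl
  | succ n ih => intro a; simpa using ih

theorem IsDiffOp.succ {n : ℕ} {P : Module.End ℤ R} (h : IsDiffOp n P) :
    IsDiffOp (n + 1) P := by
  induction n generalizing P with
  | zero =>
    obtain rfl : P = 0 := h
    exact IsDiffOp.zero 1
  | succ n ih => intro a; exact ih (h a)

theorem IsDiffOp.mono {n m : ℕ} {P : Module.End ℤ R} (h : IsDiffOp n P) (hnm : n ≤ m) :
    IsDiffOp m P := by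
  induction m, hnm using Nat.le_induction with
  | base => exact h
  | succ m _ ih => exact ih.succ

theorem IsDiffOp.add {n : ℕ} {P Q : Module.End ℤ R} (hP : IsDiffOp n P) (hQ : IsDiffOp n Q) :
    IsDiffOp n (P + Q) := by
  induction n generalizing P Q with
  | zero =>
    obtain rfl : P = 0 := hP
    obtain rfl : Q = 0 := hQ
    exact add_zero 0
  | succ n ih =>
    intro a
    have := ih (hP a) (hQ a)
    rwa [← add_sub_add_comm, ← add_mul, ← mul_add] at this

theorem IsDiffOp.neg {n : ℕ} {P : Module.End ℤ R} (hP : IsDiffOp n P) : IsDiffOp n (-P) := by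
  induction n generalizing P with
  | zero =>
    obtain rfl : P = 0 := hP
    exact neg_zero
  | succ n ih =>
    intro a
    have := ih (hP a)
    rwa [neg_sub', sub_neg_eq_add, neg_mul_eq_neg_mul, ← sub_neg_eq_add, neg_mul_eq_mul_neg] at this

theorem IsDiffOp.mul {n m : ℕ} {P Q : Module.End ℤ R} (hP : IsDiffOp n P) (hQ : IsDiffOp m Q) :
    IsDiffOp (n + m) (P * Q) := by
  induction n generalizing m P Q with
  | zero =>
    obtain rfl : P = 0 := hP
    rw [zero_mul]; exact IsDiffOp.zero _
  | succ n ihn =>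
    induction m generalizing Q with
    | zero =>
      obtain rfl : Q = 0 := hQ
      rw [mul_zero]; exact IsDiffOp.zero _
    | succ m ihm =>
      intro a
      have h1 : IsDiffOp (n + 1 + m) _ := ihm (hQ a)
      have h2 : IsDiffOp (n + (m + 1)) _ := ihn (hP a) hQ
      have h3 := h1.add (h2.mono (by omega))
      have e : P * (Q * LinearMap.mulLeft ℤ a - LinearMap.mulLeft ℤ a * Q)
          + (P * LinearMap.mulLeft ℤ a - LinearMap.mulLeft ℤ a * P) * Q
          = P * Q * LinearMap.mulLeft ℤ a - LinearMap.mulLeft ℤ a * (P * Q) := by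
        noncomm_ring
      rw [e] at h3
      exact h3

theorem IsDiffOp.one : IsDiffOp 1 (1 : Module.End ℤ R) := by
  intro a
  simp [IsDiffOp]

variable (R) in
/-- The ring `D_R` of all differential operators of `R`, a subring of the ring of additive
(equivalently, if `R` has characteristic `p`, of `𝔽_p`-linear) endomorphisms of `R`. -/
def diffOps : Subring (Module.End ℤ R) where
  carrier := {P | ∃ n, IsDiffOp n P}
  mul_mem' := fun ⟨_, hP⟩ ⟨_, hQ⟩ => ⟨_, hP.mul hQ⟩
  one_mem' := ⟨1, IsDiffOp.one⟩
  add_mem' := fun ⟨n, hP⟩ ⟨m, hQ⟩ =>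
    ⟨max n m, (hP.mono (le_max_left _ _)).add (hQ.mono (le_max_right _ _))⟩
  zero_mem' := ⟨0, IsDiffOp.zero 0⟩
  neg_mem' := fun ⟨n, hP⟩ => ⟨n, hP.neg⟩

variable (R) in
/-- The ring `D_R^k = End_{R^{p^k}}(R)`. -/
def diffOpsLevel (p k : ℕ) : Subring (Module.End ℤ R) where
  carrier := {P | ∀ a b : R, P (a ^ p ^ k * b) = a ^ p ^ k * P b}
  mul_mem' := fun {P Q} hP hQ a b => by
    rw [Module.End.mul_apply, hQ, hP, Module.End.mul_apply]
  one_mem' := fun a b => rfl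
  add_mem' := fun {P Q} hP hQ a b => by
    rw [LinearMap.add_apply, hQ, hP, LinearMap.add_apply, mul_add]
  zero_mem' := fun a b => by simp
  neg_mem' := fun {P} hP a b => by
    rw [LinearMap.neg_apply, hP, LinearMap.neg_apply, mul_neg]

theorem diffOpsLevel_mono (p : ℕ) {k l : ℕ} (h : k ≤ l) :
    diffOpsLevel R p k ≤ diffOpsLevel R p l := by
  intro P hP a b
  obtain ⟨d, rfl⟩ := Nat.exists_eq_add_of_le' h
  have := hP (a ^ p ^ d) b
  rwa [← pow_mul, ← pow_add] at this

theorem IsDiffOp.mem_level {p : ℕ} [Fact p.Prime] [CharP R p] {n k : ℕ} (hn : n ≤ p ^ k)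
    {P : Module.End ℤ R} (hP : IsDiffOp n P) : P ∈ diffOpsLevel R p k := by
  intro a b
  let E := Module.End ℤ R
  let l : E := LinearMap.mulLeft ℤ a
  let X : Module.End ℤ E := LinearMap.mulRight ℤ l
  let Y : Module.End ℤ E := LinearMap.mulLeft ℤ l
  have hit : ∀ (j : ℕ) (Q : E), IsDiffOp j Q → ((X - Y) ^ j) Q = 0 := by
    intro j
    induction j with
    | zero => intro Q hQ; exact hQ
    | succ j ih =>
      intro Q hQ
      rw [pow_succ, Module.End.mul_apply]
      exact ih _ (hQ a)
  have hcomm : Commute X Y := by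
    ext Q : 1
    simp [X, Y, mul_assoc]
  have h1 : CharP E p := charP_of_injective_ringHom
    (f := (Algebra.lmul ℤ R).toRingHom) (fun x y h => by
      simpa using LinearMap.congr_fun h (1 : R)) p
  have h2 : CharP (Module.End ℤ E) p := charP_of_injective_ringHom
    (f := (Algebra.lmul ℤ E).toRingHom) (fun x y h => by
      simpa using LinearMap.congr_fun h (1 : E)) p
  have h3 := hit _ P (hP.mono hn)
  rw [sub_pow_char_pow_of_commute p k hcomm] at h3
  have h4 : (P * LinearMap.mulLeft ℤ a ^ p ^ k - LinearMap.mulLeft ℤ a ^ p ^ k * P) b = 0 := by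
    simp only [X, Y, LinearMap.pow_mulRight, LinearMap.pow_mulLeft] at h3
    exact LinearMap.congr_fun h3 b
  rw [LinearMap.pow_mulLeft] at h4
  exact sub_eq_zero.mp h4

end DiffOps

/-! ### Frobenius pull-back, unit `R[F^e]`-modules and their `D_R`-module structure -/

section FrobTwist

/-- The `R`-`R`-bimodule `R^k`: the ring `R` (left structure), with the right `R`-module
structure given by the `k`-th iterate of Frobenius. The right structure is recorded as an
`R`-algebra structure. -/
def FrobTwist (_p _k : ℕ) (R : Type*) : Type _ := R

variable (p k : ℕ) (R : Type*) [CommRing R]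

instance : CommRing (FrobTwist p k R) := inferInstanceAs (CommRing R)

/-- An element of `R`, seen in `R^k`. -/
def toTwist : R ≃+* FrobTwist p k R := RingEquiv.refl R

theorem FrobTwist.ind {p k : ℕ} {R : Type*} [CommRing R] {motive : FrobTwist p k R → Prop}
    (h : ∀ a, motive (toTwist p k R a)) (x : FrobTwist p k R) : motive x := h x

variable [Fact p.Prime] [CharP R p]

instance : Algebra R (FrobTwist p k R) :=
  ((toTwist p k R).toRingHom.comp (iterateFrobenius R p k)).toAlgebra

variable {p k R}

theorem FrobTwist.smul_def (c : R) (a : R) :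
    c • toTwist p k R a = toTwist p k R (c ^ p ^ k * a) := by
  rw [Algebra.smul_def, map_mul]
  rfl

/-- An element of `D_R^k` as a right `R`-linear endomorphism of `R^k`. -/
def diffOpsLevel.toLin (P : diffOpsLevel R p k) : FrobTwist p k R →ₗ[R] FrobTwist p k R where
  toFun x := toTwist p k R (P.1 ((toTwist p k R).symm x))
  map_add' x y := by simp
  map_smul' c x := by
    induction x using FrobTwist.ind with
    | h a =>
      simp only [RingHom.id_apply, FrobTwist.smul_def, RingEquiv.symm_apply_apply]
      rw [P.2 c a]

@[simp]
theorem diffOpsLevel.toLin_apply (P : diffOpsLevel R p k) (a : R) :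
    diffOpsLevel.toLin P (toTwist p k R a) = toTwist p k R (P.1 a) := rfl

theorem finite_twist (hF : (frobenius R p).Finite) (k : ℕ) :
    Module.Finite R (FrobTwist p k R) := by
  have h : ∀ k, (iterateFrobenius R p k).Finite := by
    intro k
    induction k with
    | zero => rw [iterateFrobenius_zero]; exact RingHom.Finite.id R
    | succ k ih =>
      have : iterateFrobenius R p (k + 1) = (frobenius R p).comp (iterateFrobenius R p k) := by
        ext x
        simp [iterateFrobenius_def, frobenius_def, pow_succ, pow_mul]
      rw [this]
      exact hF.comp ih
  exact h k

theorem level_le_diffOps (hF : (frobenius R p).Finite) (k : ℕ) :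
    diffOpsLevel R p k ≤ diffOps R := by
  intro P hP
  let S := FrobTwist p k R
  have := finite_twist hF k
  let I := KaehlerDifferential.ideal R S
  have hI : IsNilpotent I := by
    refine (Ideal.FG.isNilpotent_iff_le_nilradical (KaehlerDifferential.ideal_fg R S)).2 ?_
    rw [← KaehlerDifferential.span_range_eq_ideal, Ideal.span_le]
    rintro _ ⟨s, rfl⟩
    refine ⟨p ^ k, ?_⟩
    have h1 : CharP S p := inferInstanceAs (CharP R p)
    have h2 : CharP (S ⊗[R] S) p := charP_of_injective_ringHom
      (f := (Algebra.TensorProduct.includeLeft : S →ₐ[R] S ⊗[R] S).toRingHom) (fun x y h => by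
        simpa using congrArg (Algebra.TensorProduct.lmul' R) h) p
    have h3 : s ^ p ^ k = algebraMap R S ((toTwist p k R).symm s) := rfl
    rw [sub_pow_char_pow, Algebra.TensorProduct.tmul_pow, Algebra.TensorProduct.tmul_pow,
      one_pow, h3, Algebra.algebraMap_eq_smul_one, TensorProduct.smul_tmul, sub_self]
    exact Submodule.zero_mem _
  obtain ⟨n, hn⟩ := hI
  let Φ : S ⊗[R] S →ₐ[R] Module.End R (Module.End R S) :=
    Algebra.TensorProduct.lift
      ((Algebra.lmul R (Module.End R S)).comp (Algebra.lmul R S))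
      (AlgHom.ofLinearMap
        ((LinearMap.mul R (Module.End R S)).flip ∘ₗ (Algebra.lmul R S).toLinearMap)
        (by ext; simp) (fun x y => by ext Q z; simp [mul_assoc, mul_left_comm]))
      (fun x y => by ext Q z; simp)
  have hΦ : ∀ (x y : S) (Q : Module.End R S) (z : S), Φ (x ⊗ₜ y) Q z = x * Q (y * z) := by
    intro x y Q z
    simp only [Φ]
    rfl
  have key : ∀ (n : ℕ) (Q : diffOpsLevel R p k),
      (∀ z ∈ I ^ n, Φ z (diffOpsLevel.toLin Q) = 0) → IsDiffOp n Q.1 := by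
    intro n
    induction n with
    | zero =>
      intro Q hQ
      have h0 := hQ 1 (by simp)
      rw [map_one, Module.End.one_apply] at h0
      ext z
      exact LinearMap.congr_fun h0 (toTwist p k R z)
    | succ n ih =>
      intro Q hQ a
      have hl : LinearMap.mulLeft ℤ a ∈ diffOpsLevel R p k := fun c d => by
        simp only [LinearMap.mulLeft_apply]; ring
      refine ih ⟨Q.1 * LinearMap.mulLeft ℤ a - LinearMap.mulLeft ℤ a * Q.1,
        sub_mem (mul_mem Q.2 hl) (mul_mem hl Q.2)⟩ (fun z hz => ?_)
      have h1 := hQ (z * (1 ⊗ₜ toTwist p k R a - toTwist p k R a ⊗ₜ 1)) (by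
        rw [pow_succ]
        exact Ideal.mul_mem_mul hz
          (KaehlerDifferential.one_smul_sub_smul_one_mem_ideal R (toTwist p k R a)))
      rw [map_mul, Module.End.mul_apply] at h1
      rw [← h1]
      congr 1
      ext y
      rw [map_sub, LinearMap.sub_apply, LinearMap.sub_apply, hΦ, hΦ]
      rw [one_mul, one_mul]
      rfl
  refine ⟨n, key n ⟨P, hP⟩ (fun z hz => ?_)⟩
  rw [hn] at hz
  have : z = 0 := hz
  rw [this, map_zero, LinearMap.zero_apply]

/-- Over an `F`-finite ring, `D_R` is the union of the `D_R^k`. -/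
theorem mem_diffOps_iff (hF : (frobenius R p).Finite) (P : Module.End ℤ R) :
    P ∈ diffOps R ↔ ∃ k, P ∈ diffOpsLevel R p k := by
  refine ⟨fun ⟨n, hP⟩ => ?_, fun ⟨k, hk⟩ => level_le_diffOps hF k hk⟩
  exact ⟨n, hP.mem_level (Nat.lt_pow_self (Fact.out : p.Prime).one_lt).le⟩

end FrobTwist

section FrobModule

/-- An `R[F^e]`-module structure on the `R`-module `M`: an additive map `F^e : M → M` with
`F^e (a u) = a^{p^e} F^e u`. -/
structure FrobAction (p e : ℕ) (R M : Type*) [CommRing R] [AddCommGroup M] [Module R M] where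
  /-- The map `F^e`. -/
  toHom : M →+ M
  map_smul : ∀ (a : R) (u : M), toHom (a • u) = a ^ p ^ e • toHom u

namespace FrobAction

variable {p e : ℕ} {R M : Type*} [CommRing R] [AddCommGroup M] [Module R M]

/-- The `R[F^{se}]`-module underlying an `R[F^e]`-module. -/
def iter (φ : FrobAction p e R M) : (s : ℕ) → FrobAction p (s * e) R M
  | 0 => ⟨AddMonoidHom.id M, fun a u => by simp⟩
  | s + 1 => ⟨φ.toHom.comp (φ.iter s).toHom, fun a u => by
      rw [AddMonoidHom.comp_apply, (φ.iter s).map_smul, φ.map_smul, ← pow_mul, ← pow_add,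
        Nat.succ_mul]
      rfl⟩

theorem iter_add (φ : FrobAction p e R M) (s t : ℕ) (u : M) :
    (φ.iter (s + t)).toHom u = (φ.iter s).toHom ((φ.iter t).toHom u) := by
  induction s with
  | zero => rw [Nat.zero_add]; rfl
  | succ s ih =>
    rw [Nat.succ_add]
    exact congrArg φ.toHom ih

variable [Fact p.Prime] [CharP R p]

/-- The structure map `θ : R^e ⊗_R M → M`, `θ (a ⊗ u) = a F^e(u)`. -/
def theta (φ : FrobAction p e R M) : FrobTwist p e R ⊗[R] M →+ M :=
  TensorProduct.liftAddHom
    { toFun := fun a =>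
        { toFun := fun u => (toTwist p e R).symm a • φ.toHom u
          map_zero' := by simp
          map_add' := by simp }
      map_zero' := by ext; simp
      map_add' := fun a b => by ext; simp [add_smul] }
    (fun c a u => by
      induction a using FrobTwist.ind with
      | h a =>
        simp only [AddMonoidHom.coe_mk, ZeroHom.coe_mk, FrobTwist.smul_def, φ.map_smul,
          RingEquiv.symm_apply_apply, smul_smul, mul_comm])

@[simp]
theorem theta_tmul (φ : FrobAction p e R M) (a : R) (u : M) :
    φ.theta (toTwist p e R a ⊗ₜ u) = a • φ.toHom u := rfl

/-- The `R[F^e]`-module is unit: `θ` is an isomorphism. -/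
def IsUnit (φ : FrobAction p e R M) : Prop := Function.Bijective φ.theta

theorem theta_smul (φ : FrobAction p e R M) (a : R) (t : FrobTwist p e R ⊗[R] M) :
    φ.theta (toTwist p e R a • t) = a • φ.theta t := by
  induction t using TensorProduct.induction_on with
  | zero => simp
  | add x y hx hy => simp only [smul_add, map_add, hx, hy]
  | tmul b u =>
    induction b using FrobTwist.ind with
    | h b => rw [TensorProduct.smul_tmul', smul_eq_mul, ← map_mul, theta_tmul, theta_tmul, mul_smul]

/-- The map `R^k ⊗ M → R^{k+e} ⊗ M`, `b ⊗ v ↦ b^{p^e} ⊗ v`. -/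
def twistHom (p e k : ℕ) (R M : Type*) [CommRing R] [AddCommGroup M] [Module R M]
    [Fact p.Prime] [CharP R p] :
    FrobTwist p k R ⊗[R] M →+ FrobTwist p (k + e) R ⊗[R] M :=
  TensorProduct.liftAddHom
    { toFun := fun a =>
        { toFun := fun u =>
            toTwist p (k + e) R (iterateFrobenius R p e ((toTwist p k R).symm a)) ⊗ₜ u
          map_zero' := by simp
          map_add' := by simp [TensorProduct.tmul_add] }
      map_zero' := by ext; simp
      map_add' := fun a b => by ext; simp [TensorProduct.add_tmul] }
    (fun c a u => by
      induction a using FrobTwist.ind with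
      | h a =>
        simp only [AddMonoidHom.coe_mk, ZeroHom.coe_mk, ← TensorProduct.smul_tmul,
          FrobTwist.smul_def, RingEquiv.symm_apply_apply, iterateFrobenius_def, mul_pow,
          ← pow_mul, ← pow_add])

theorem twistHom_tmul (k : ℕ) (b : R) (v : M) :
    twistHom p e k R M (toTwist p k R b ⊗ₜ v) = toTwist p (k + e) R (b ^ p ^ e) ⊗ₜ v := rfl

theorem twistHom_smul (k : ℕ) (c : R) (t : FrobTwist p k R ⊗[R] M) :
    twistHom p e k R M (toTwist p k R c • t)
      = toTwist p (k + e) R (c ^ p ^ e) • twistHom p e k R M t := by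
  induction t using TensorProduct.induction_on with
  | zero => simp
  | add x y hx hy => simp only [smul_add, map_add, hx, hy]
  | tmul b u =>
    induction b using FrobTwist.ind with
    | h b =>
      rw [TensorProduct.smul_tmul', smul_eq_mul, ← map_mul, twistHom_tmul, twistHom_tmul,
        TensorProduct.smul_tmul', smul_eq_mul, ← map_mul, mul_pow]

theorem IsUnit.iter {φ : FrobAction p e R M} (h : φ.IsUnit) (s : ℕ) : (φ.iter s).IsUnit := by
  induction s with
  | zero =>
    have h0 : ∀ t : FrobTwist p (0 * e) R ⊗[R] M,
        toTwist p (0 * e) R 1 ⊗ₜ (φ.iter 0).theta t = t := by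
      intro t
      induction t using TensorProduct.induction_on with
      | zero => simp
      | add x y hx hy => rw [map_add, TensorProduct.tmul_add, hx, hy]
      | tmul b u =>
        induction b using FrobTwist.ind with
        | h b =>
          rw [theta_tmul, ← TensorProduct.smul_tmul, FrobTwist.smul_def]
          simp [FrobAction.iter]
    refine ⟨fun x y hxy => ?_, fun x => ⟨toTwist p (0 * e) R 1 ⊗ₜ x, ?_⟩⟩
    · rw [← h0 x, hxy, h0 y]
    · rw [theta_tmul, one_smul]; rfl
  | succ s ih =>
    let ψ := φ.iter s
    let inv : M → FrobTwist p (s * e) R ⊗[R] M := (Equiv.ofBijective _ ih).symm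
    have inv_theta : ∀ t, inv (ψ.theta t) = t := (Equiv.ofBijective _ ih).symm_apply_apply
    have theta_inv : ∀ x, ψ.theta (inv x) = x := (Equiv.ofBijective _ ih).apply_symm_apply
    have inv_add : ∀ x y, inv (x + y) = inv x + inv y := fun x y => ih.1 (by
      change ψ.theta _ = ψ.theta _
      rw [map_add, theta_inv, theta_inv, theta_inv])
    have inv_zero : inv 0 = 0 := ih.1 (by
      change ψ.theta _ = ψ.theta _
      rw [map_zero, theta_inv])
    have inv_smul : ∀ (c : R) x, inv (c • x) = toTwist p (s * e) R c • inv x := fun c x => ih.1 (by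
      change ψ.theta _ = ψ.theta _
      rw [theta_smul, theta_inv, theta_inv])
    let Ψ : FrobTwist p e R ⊗[R] M →+ FrobTwist p (s * e + e) R ⊗[R] M :=
      TensorProduct.liftAddHom
        { toFun := fun a =>
            { toFun := fun u => toTwist p (s * e + e) R ((toTwist p e R).symm a) •
                twistHom p e (s * e) R M (inv u)
              map_zero' := by rw [inv_zero]; simp
              map_add' := fun u v => by rw [inv_add]; simp }
          map_zero' := by ext; simp
          map_add' := fun a b => by ext; simp [add_smul] }
        (fun c a u => by
          induction a using FrobTwist.ind with
          | h a =>
            simp only [AddMonoidHom.coe_mk, ZeroHom.coe_mk, FrobTwist.smul_def, inv_smul,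
              twistHom_smul, RingEquiv.symm_apply_apply, smul_smul, ← map_mul, mul_comm])
    have hΨ : ∀ (a : R) (u : M), Ψ (toTwist p e R a ⊗ₜ u)
        = toTwist p (s * e + e) R a • twistHom p e (s * e) R M (inv u) := fun a u => rfl
    have hs : (s + 1) * e = s * e + e := Nat.succ_mul s e
    let χ : FrobAction p (s * e + e) R M := ⟨φ.toHom.comp ψ.toHom, fun a u => by
      rw [AddMonoidHom.comp_apply, ψ.map_smul, φ.map_smul, ← pow_mul, ← pow_add]; rfl⟩
    suffices hχ : χ.IsUnit by
      have : ∀ (k : ℕ) (hk : k = s * e + e) (ω : FrobAction p k R M),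
          ω.toHom = χ.toHom → ω.IsUnit := by
        rintro k rfl ⟨_, _⟩ rfl
        exact hχ
      exact this _ hs _ rfl
    let inv' : M → FrobTwist p e R ⊗[R] M := (Equiv.ofBijective _ h).symm
    have inv'_theta : ∀ t, inv' (φ.theta t) = t := (Equiv.ofBijective _ h).symm_apply_apply
    have theta_inv' : ∀ x, φ.theta (inv' x) = x := (Equiv.ofBijective _ h).apply_symm_apply
    have key1 : ∀ t, χ.theta (Ψ t) = φ.theta t := by
      intro t
      induction t using TensorProduct.induction_on with
      | zero => simp
      | add x y hx hy => rw [map_add, map_add, map_add, hx, hy]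
      | tmul b u =>
        induction b using FrobTwist.ind with
        | h b =>
          rw [hΨ, theta_smul, theta_tmul]
          congr 1
          have : ∀ t, χ.theta (twistHom p e (s * e) R M t) = φ.toHom (ψ.theta t) := by
            intro t
            induction t using TensorProduct.induction_on with
            | zero => simp
            | add x y hx hy => simp only [map_add, hx, hy]
            | tmul b u =>
              induction b using FrobTwist.ind with
              | h b => rw [twistHom_tmul, theta_tmul, theta_tmul, φ.map_smul]; rfl
          rw [this, theta_inv]
    have key2 : ∀ t, Ψ (inv' (χ.theta t)) = t := by
      intro t
      have add' : ∀ x y, inv' (x + y) = inv' x + inv' y := fun x y => h.1 (by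
        rw [map_add, theta_inv', theta_inv', theta_inv'])
      induction t using TensorProduct.induction_on with
      | zero => rw [map_zero, ← map_zero φ.theta, inv'_theta, map_zero]
      | add x y hx hy => rw [map_add, add', map_add, hx, hy]
      | tmul b u =>
        induction b using FrobTwist.ind with
        | h b =>
          have e1 : χ.theta (toTwist p (s * e + e) R b ⊗ₜ u)
              = φ.theta (toTwist p e R b ⊗ₜ ψ.toHom u) := rfl
          have e2 : ψ.toHom u = ψ.theta (toTwist p (s * e) R 1 ⊗ₜ u) := by
            rw [theta_tmul, one_smul]
          rw [e1, inv'_theta, hΨ, e2, inv_theta, twistHom_tmul, one_pow,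
            TensorProduct.smul_tmul', smul_eq_mul, map_one, mul_one]
    refine ⟨fun x y hxy => ?_, fun x => ⟨Ψ (inv' x), ?_⟩⟩
    · rw [← key2 x, hxy, key2 y]
    · rw [key1, theta_inv']

/-- The action of `P ∈ D_R^{se}` on a unit `R[F^e]`-module `M`: it is the action
`P (a ⊗ u) = P(a) ⊗ u` on `R^{se} ⊗ M`, transported through the isomorphism
`θ^{se} : R^{se} ⊗ M → M`. -/
noncomputable def levelAct (φ : FrobAction p e R M) (h : φ.IsUnit) (s : ℕ)
    (P : diffOpsLevel R p (s * e)) (x : M) : M :=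
  (φ.iter s).theta (LinearMap.rTensor M (diffOpsLevel.toLin P)
    ((Equiv.ofBijective _ (h.iter s)).symm x))

theorem levelAct_theta (φ : FrobAction p e R M) (h : φ.IsUnit) (s : ℕ)
    (P : diffOpsLevel R p (s * e)) (t : FrobTwist p (s * e) R ⊗[R] M) :
    φ.levelAct h s P ((φ.iter s).theta t)
      = (φ.iter s).theta (LinearMap.rTensor M (diffOpsLevel.toLin P) t) := by
  unfold levelAct
  congr 2
  exact (Equiv.ofBijective _ (h.iter s)).symm_apply_apply t

theorem levelAct_add (φ : FrobAction p e R M) (h : φ.IsUnit) (s : ℕ)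
    (P : diffOpsLevel R p (s * e)) (x y : M) :
    φ.levelAct h s P (x + y) = φ.levelAct h s P x + φ.levelAct h s P y := by
  obtain ⟨t, rfl⟩ := (h.iter s).2 x
  obtain ⟨u, rfl⟩ := (h.iter s).2 y
  rw [← map_add, levelAct_theta, levelAct_theta, levelAct_theta, map_add, map_add]

theorem levelAct_smul (φ : FrobAction p e R M) (h : φ.IsUnit) (s : ℕ)
    (P : diffOpsLevel R p (s * e)) (a : R) (u : M) :
    φ.levelAct h s P (a • (φ.iter s).toHom u) = P.1 a • (φ.iter s).toHom u := by
  rw [← theta_tmul, levelAct_theta, LinearMap.rTensor_tmul, diffOpsLevel.toLin_apply, theta_tmul]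

theorem iter_induction (φ : FrobAction p e R M) (h : φ.IsUnit) (s : ℕ) {motive : M → Prop}
    (smul : ∀ (a : R) (u : M), motive (a • (φ.iter s).toHom u))
    (add : ∀ x y, motive x → motive y → motive (x + y)) (x : M) : motive x := by
  obtain ⟨t, rfl⟩ := (h.iter s).2 x
  induction t using TensorProduct.induction_on with
  | zero => simpa using smul 0 0
  | add x y hx hy => rw [map_add]; exact add _ _ hx hy
  | tmul b u =>
    induction b using FrobTwist.ind with
    | h b => exact smul b u

/-- The actions of `P` obtained by viewing it in `D_R^{se}` and in `D_R^{te}` agree. -/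
theorem levelAct_eq (φ : FrobAction p e R M) (h : φ.IsUnit) {s t : ℕ} (P : Module.End ℤ R)
    (hs : P ∈ diffOpsLevel R p (s * e)) (ht : P ∈ diffOpsLevel R p (t * e)) (x : M) :
    φ.levelAct h s ⟨P, hs⟩ x = φ.levelAct h t ⟨P, ht⟩ x := by
  induction x using φ.iter_induction h (s + t) with
  | add x y hx hy => rw [levelAct_add, levelAct_add, hx, hy]
  | smul a u =>
    nth_rw 1 [iter_add]
    rw [levelAct_smul, add_comm s t, iter_add, levelAct_smul, ← iter_add, ← iter_add, add_comm]

theorem exists_level [NeZero e] (P : diffOps R) : ∃ s, P.1 ∈ diffOpsLevel R p (s * e) := by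
  obtain ⟨n, hP⟩ := P.2
  refine ⟨n, hP.mem_level ?_⟩
  exact (Nat.lt_pow_self (Fact.out : p.Prime).one_lt).le.trans
    (Nat.pow_le_pow_right (Fact.out : p.Prime).pos (Nat.le_mul_of_pos_right n (NeZero.pos e)))

/-- The action of `P ∈ D_R` on a unit `R[F^e]`-module, defined by viewing `P` as an element of
`D_R^{se}` for some `s`. -/
noncomputable def act [NeZero e] (φ : FrobAction p e R M) (h : φ.IsUnit) (P : diffOps R)
    (x : M) : M :=
  φ.levelAct h (exists_level (p := p) (e := e) P).choose
    ⟨P.1, (exists_level (p := p) (e := e) P).choose_spec⟩ x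

theorem act_eq [NeZero e] (φ : FrobAction p e R M) (h : φ.IsUnit) (P : diffOps R) {s : ℕ}
    (hs : P.1 ∈ diffOpsLevel R p (s * e)) (x : M) : φ.act h P x = φ.levelAct h s ⟨P.1, hs⟩ x :=
  φ.levelAct_eq h P.1 _ hs x

theorem act_smul [NeZero e] (φ : FrobAction p e R M) (h : φ.IsUnit) (P : diffOps R) {s : ℕ}
    (hs : P.1 ∈ diffOpsLevel R p (s * e)) (a : R) (u : M) :
    φ.act h P (a • (φ.iter s).toHom u) = P.1 a • (φ.iter s).toHom u := by
  rw [act_eq φ h P hs, levelAct_smul]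

theorem act_add [NeZero e] (φ : FrobAction p e R M) (h : φ.IsUnit) (P : diffOps R) (x y : M) :
    φ.act h P (x + y) = φ.act h P x + φ.act h P y :=
  φ.levelAct_add h _ _ x y

/-- The canonical `D_R`-module structure on a unit `R[F^e]`-module. -/
@[reducible]
noncomputable def diffOpsModule [NeZero e] (φ : FrobAction p e R M) (h : φ.IsUnit) :
    Module (diffOps R) M where
  smul P x := φ.act h P x
  one_smul x := by
    change φ.act h 1 x = x
    induction x using φ.iter_induction h 0 with
    | add x y hx hy => rw [act_add, hx, hy]
    | smul a u => rw [act_smul φ h 1 (one_mem _)]; rfl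
  mul_smul P Q x := by
    change φ.act h (P * Q) x = φ.act h P (φ.act h Q x)
    obtain ⟨s, hs⟩ := exists_level (p := p) (e := e) P
    obtain ⟨t, ht⟩ := exists_level (p := p) (e := e) Q
    have hs' := diffOpsLevel_mono p (Nat.mul_le_mul_right e (le_max_left s t)) hs
    have ht' := diffOpsLevel_mono p (Nat.mul_le_mul_right e (le_max_right s t)) ht
    induction x using φ.iter_induction h (max s t) with
    | add x y hx hy => simp only [act_add, hx, hy]
    | smul a u =>
      rw [act_smul φ h (P * Q) (mul_mem hs' ht'), act_smul φ h Q ht', act_smul φ h P hs']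
      rfl
  smul_zero P := by
    change φ.act h P 0 = 0
    have := φ.act_add h P 0 0
    rwa [add_zero, left_eq_add] at this
  smul_add P x y := φ.act_add h P x y
  add_smul P Q x := by
    change φ.act h (P + Q) x = φ.act h P x + φ.act h Q x
    obtain ⟨s, hs⟩ := exists_level (p := p) (e := e) P
    obtain ⟨t, ht⟩ := exists_level (p := p) (e := e) Q
    have hs' := diffOpsLevel_mono p (Nat.mul_le_mul_right e (le_max_left s t)) hs
    have ht' := diffOpsLevel_mono p (Nat.mul_le_mul_right e (le_max_right s t)) ht
    induction x using φ.iter_induction h (max s t) with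
    | add x y hx hy => simp only [act_add, hx, hy]; abel
    | smul a u =>
      rw [act_smul φ h (P + Q) (add_mem hs' ht'), act_smul φ h Q ht', act_smul φ h P hs',
        ← add_smul]
      rfl
  zero_smul x := by
    change φ.act h 0 x = 0
    induction x using φ.iter_induction h 0 with
    | add x y hx hy => rw [act_add, hx, hy, add_zero]
    | smul a u =>
      rw [act_smul φ h 0 (zero_mem _)]
      exact zero_smul R _

end FrobAction

end FrobModule

/-! ### The module `M_α` -/

section MAlpha

/-- The module `M_α`, `α = r / (p^e - 1)`: the free `R_f`-module of rank one with generator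
`e_α`. Its elements `x e_α` are represented by their coordinates `x ∈ R_f`. -/
def MAlpha {R : Type*} [CommRing R] (_p _e _r : ℕ) (f : R) : Type _ := Localization.Away f

namespace MAlpha

variable {R : Type*} [CommRing R] (p e r : ℕ) (f : R)

noncomputable instance : AddCommGroup (MAlpha p e r f) :=
  inferInstanceAs (AddCommGroup (Localization.Away f))

noncomputable instance : Module (Localization.Away f) (MAlpha p e r f) :=
  inferInstanceAs (Module (Localization.Away f) (Localization.Away f))

noncomputable instance : Module R (MAlpha p e r f) :=
  inferInstanceAs (Module R (Localization.Away f))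

instance : IsScalarTower R (Localization.Away f) (MAlpha p e r f) :=
  inferInstanceAs (IsScalarTower R (Localization.Away f) (Localization.Away f))

/-- The generator `e_α`. -/
noncomputable def gen : MAlpha p e r f := (1 : Localization.Away f)

/-- The fraction `b / f^m` in `R_f`. -/
noncomputable def frac (b : R) (m : ℕ) : Localization.Away f :=
  Localization.mk b ⟨f ^ m, m, rfl⟩

theorem frac_mul (b c : R) (m n : ℕ) : frac f b m * frac f c n = frac f (b * c) (m + n) := by
  rw [frac, frac, frac, Localization.mk_mul]
  congr 1
  exact Subtype.ext (pow_add f m n).symm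

theorem exists_frac (x : MAlpha p e r f) : ∃ b m, x = frac f b m • gen p e r f := by
  obtain ⟨b, ⟨_, m, rfl⟩, h⟩ := IsLocalization.exists_mk'_eq (Submonoid.powers f)
    (show Localization.Away f from x)
  rw [← Localization.mk_eq_mk'] at h
  exact ⟨b, m, h.symm.trans (mul_one (frac f b m)).symm⟩

theorem smul_frac (a b : R) (m : ℕ) :
    a • (frac f b m • gen p e r f) = frac f (a * b) m • gen p e r f := by
  rw [← smul_assoc]
  congr 1
  exact Localization.smul_mk a b _

variable [Fact p.Prime] [CharP R p]

theorem add_pow_loc (x y : Localization.Away f) :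
    (x + y) ^ p ^ e = x ^ p ^ e + y ^ p ^ e := by
  have hp : ((p : ℕ) : Localization.Away f) = 0 := by
    rw [← map_natCast (algebraMap R (Localization.Away f)) p, CharP.cast_eq_zero, map_zero]
  rcases subsingleton_or_nontrivial (Localization.Away f) with h | h
  · exact Subsingleton.elim _ _
  · have : CharP (Localization.Away f) p :=
      ringChar.of_eq (CharP.ringChar_of_prime_eq_zero (Fact.out : p.Prime) hp)
    exact add_pow_char_pow x y p e

/-- The action of `F^e` on `M_α`: `F^e (x e_α) = (x^{p^e} / f^r) e_α`. -/
noncomputable def frob : FrobAction p e R (MAlpha p e r f) where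
  toHom :=
    { toFun := fun x =>
        ((show Localization.Away f from x) ^ p ^ e * frac f 1 r : Localization.Away f)
      map_zero' := by
        change (0 : Localization.Away f) ^ p ^ e * _ = (0 : Localization.Away f)
        rw [zero_pow (pow_ne_zero e (Fact.out : p.Prime).ne_zero), zero_mul]
      map_add' := fun x y => by
        have h := add_pow_loc p e f x y
        exact (congrArg (· * frac f 1 r) h).trans (add_mul (R := Localization.Away f) _ _ _) }
  map_smul a u := by
    change (a • (show Localization.Away f from u)) ^ p ^ e * frac f 1 r
      = a ^ p ^ e • ((show Localization.Away f from u) ^ p ^ e * frac f 1 r)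
    rw [smul_pow, smul_mul_assoc]

/-- `F^e ((b / f^m) e_α) = (b^{p^e} / f^{m p^e + r}) e_α`. -/
theorem frob_frac (b : R) (m : ℕ) :
    (frob p e r f).toHom (frac f b m • gen p e r f)
      = frac f (b ^ p ^ e) (m * p ^ e + r) • gen p e r f := by
  change (frac f b m * 1) ^ p ^ e * frac f 1 r = frac f (b ^ p ^ e) (m * p ^ e + r) * 1
  have h : frac f b m ^ p ^ e = frac f (b ^ p ^ e) (m * p ^ e) := by
    rw [frac, frac, Localization.mk_pow]
    congr 1
    exact Subtype.ext (pow_mul f m _).symm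
  rw [mul_one, mul_one, h, frac_mul, mul_one]

theorem frac_eq (b : R) (m n : ℕ) :
    frac f b m = frac f (b * f ^ n) (m + n) := by
  have h : frac f (f ^ n) n = 1 :=
    Localization.mk_self (⟨f ^ n, n, rfl⟩ : Submonoid.powers f)
  rw [← frac_mul, h, mul_one]

/-- `M_α` is a unit `R[F^e]`-module. -/
theorem frob_isUnit : (frob p e r f).IsUnit := by
  have hq : 1 ≤ p ^ e := Nat.one_le_pow _ _ (Fact.out : p.Prime).pos
  have hsmul : ∀ (a b : R) (m : ℕ),
      toTwist p e R a ⊗ₜ[R] (frac f b m • gen p e r f)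
        = toTwist p e R (b ^ p ^ e * a) ⊗ₜ[R] (frac f 1 m • gen p e r f) := by
    intro a b m
    rw [← FrobTwist.smul_def, TensorProduct.smul_tmul, smul_frac, mul_one]
  have hup : ∀ (a : R) (m n : ℕ),
      toTwist p e R a ⊗ₜ[R] (frac f 1 m • gen p e r f)
        = toTwist p e R ((f ^ n) ^ p ^ e * a) ⊗ₜ[R] (frac f 1 (m + n) • gen p e r f) := by
    intro a m n
    rw [frac_eq f 1 m n, hsmul, one_mul]
  have hform : ∀ t : FrobTwist p e R ⊗[R] MAlpha p e r f, ∃ (a : R) (m : ℕ),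
      t = toTwist p e R a ⊗ₜ (frac f 1 m • gen p e r f) := by
    intro t
    induction t using TensorProduct.induction_on with
    | zero => exact ⟨0, 0, by rw [map_zero, TensorProduct.zero_tmul]⟩
    | tmul a u =>
      induction a using FrobTwist.ind with
      | h a =>
        obtain ⟨b, m, rfl⟩ := exists_frac p e r f u
        exact ⟨_, m, hsmul a b m⟩
    | add x y hx hy =>
      obtain ⟨a, m, rfl⟩ := hx
      obtain ⟨b, n, rfl⟩ := hy
      refine ⟨(f ^ n) ^ p ^ e * a + (f ^ m) ^ p ^ e * b, m + n, ?_⟩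
      rw [hup a m n, hup b n m, add_comm n m, map_add, TensorProduct.add_tmul]
  have htheta : ∀ (a : R) (m : ℕ),
      (frob p e r f).theta (toTwist p e R a ⊗ₜ (frac f 1 m • gen p e r f))
        = frac f a (m * p ^ e + r) • gen p e r f := by
    intro a m
    rw [FrobAction.theta_tmul, frob_frac, smul_frac, one_pow, mul_one]
  constructor
  · rw [injective_iff_map_eq_zero]
    intro t ht
    obtain ⟨a, m, rfl⟩ := hform t
    rw [htheta] at ht
    have ht' : frac f a (m * p ^ e + r) = 0 := (mul_one _).symm.trans ht
    rw [frac, Localization.mk_eq_mk', IsLocalization.mk'_eq_zero_iff] at ht'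
    obtain ⟨⟨_, n, rfl⟩, hn⟩ := ht'
    have hn' : f ^ n * a = 0 := hn
    rw [hup a m n]
    obtain ⟨d, hd⟩ := Nat.exists_eq_add_of_le' hq
    rw [hd, pow_succ, mul_assoc, hn', mul_zero, map_zero, TensorProduct.zero_tmul]
  · intro x
    obtain ⟨c, s, rfl⟩ := exists_frac p e r f x
    refine ⟨toTwist p e R (c * f ^ (s * (p ^ e - 1) + r)) ⊗ₜ (frac f 1 s • gen p e r f), ?_⟩
    rw [htheta, frac_eq f c s (s * (p ^ e - 1) + r), ← add_assoc]
    congr 3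
    obtain ⟨d, hd⟩ := Nat.exists_eq_add_of_le' hq
    rw [hd, Nat.add_sub_cancel]
    ring

/-- The `D_R`-module structure of `M_α`. -/
noncomputable instance [NeZero e] : Module (diffOps R) (MAlpha p e r f) :=
  (frob p e r f).diffOpsModule (frob_isUnit p e r f)

end MAlpha

/-- `α_m = ((p^{me} - 1) / p^{me}) α`, where `α = r / (p^e - 1)`. -/
noncomputable def alphaSeq (p e r m : ℕ) : ℝ :=
  ((p : ℝ) ^ (m * e) - 1) / (p : ℝ) ^ (m * e) * ((r : ℝ) / ((p : ℝ) ^ e - 1))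

end MAlpha

end FThreshold

namespace FThreshold

/-! ### Lifting freeness of Frobenius from A/x to A -/

section Projective

/-! Put q = p^e and g_m = r(1 + q + ⋯ + q^{m-1}), so that α_m = g_m / q^m increases to α and
τ(f^{α_m}) is the root (f^{g_m})^{[1/q^m]}. Since (F^e)^s(e_α) = f^{-g_s} e_α, an operator P of
level se sends e_α = f^{g_s} (F^e)^s(e_α) to P(f^{g_s}) (F^e)^s(e_α) (`smul_gen`). Questions about
D_R e_α thus become questions about operators applied to powers of f.

The D_R^k-submodule of R generated by h is ((h)^{[1/p^k]})^{[p^k]}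
(`exists_diffOpsLevel_apply_eq_iff`). Hence (F^e)^s(e_α) is reached from e_α by an operator of level
(t+s)e exactly when τ(f^{α_t}) ⊆ τ(f^{α_{t+s}}) (`exists_smul_gen_eq_iter_frob_iff`). The case s = 1
is the second claim.

For the first, τ(f^{α_{m+1}}) = (f^r τ(f^{α_m}))^{[1/q]} (`testIdeal_alphaSeq_succ`), so one
equality of consecutive terms makes the chain stationary. Then every f^{-g_n} e_α lies in D_R e_α,
and g_n ≥ n gives all of M_α. On the analytic side, τ(f^l) is decreasing and constant just to the
right of each l (`exists_gt_testIdeal_eq`), so jumps accumulate at α only from the left, exactly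
when the chain is not stationary (`not_accPt_jumps_iff`).

All root computations rest on R^k being finite projective and faithfully flat over R, that is, on
Kunz's theorem. It is proved on the local rings by induction on the dimension
(`isDomain_and_free_frobTwist`). -/

theorem projective_of_exact {A M₁ M₂ M₃ : Type*} [CommRing A] [AddCommGroup M₁]
    [AddCommGroup M₂] [AddCommGroup M₃] [Module A M₁] [Module A M₂] [Module A M₃]
    [Module.Projective A M₁] [Module.Projective A M₃] (i : M₁ →ₗ[A] M₂) (g : M₂ →ₗ[A] M₃)
    (hi : Function.Injective i) (hg : Function.Surjective g) (h : Function.Exact i g) :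
    Module.Projective A M₂ := by
  obtain ⟨s, hs⟩ := Module.projective_lifting_property g LinearMap.id hg
  obtain ⟨e, -⟩ := ((Function.Exact.split_tfae' h).out 0 2 rfl rfl).mp ⟨hi, s, hs⟩
  exact Module.Projective.of_equiv e.symm

open scoped Pointwise in
/-- Freeness over a Noetherian local ring is detected modulo a regular element. -/
theorem free_of_quotient_projective {A N N' : Type*} [CommRing A] [IsLocalRing A]
    [IsNoetherianRing A] [AddCommGroup N] [Module A N] [Module.Finite A N] {x : A}
    (hx : x ∈ IsLocalRing.maximalIdeal A) (hreg : IsSMulRegular N x)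
    [AddCommGroup N'] [Module (A ⧸ Ideal.span {x}) N'] [Module.Projective (A ⧸ Ideal.span {x}) N']
    (g : N →+ N') (hgs : ∀ (a : A) (n : N), g (a • n) = Ideal.Quotient.mk (Ideal.span {x}) a • g n)
    (hg : Function.Surjective g) (hker : ∀ n, g n = 0 → ∃ m, n = x • m) :
    Module.Free A N := by
  let _ : Module A N' := Module.compHom N' (Ideal.Quotient.mk (Ideal.span {x}))
  have _ : IsScalarTower A (A ⧸ Ideal.span {x}) N' :=
    ⟨fun a b n => by rw [Algebra.smul_def, mul_smul]; rfl⟩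
  let g' : N →ₗ[A] N' := { g with map_smul' := hgs }
  have hk : LinearMap.ker g' = x • (⊤ : Submodule A N) := by
    ext n
    rw [LinearMap.mem_ker, Submodule.mem_smul_pointwise_iff_exists]
    constructor
    · intro h
      obtain ⟨m, rfl⟩ := hker n h
      exact ⟨m, trivial, rfl⟩
    · rintro ⟨m, -, rfl⟩
      refine (hgs x m).trans ?_
      rw [Ideal.Quotient.eq_zero_iff_mem.mpr (Ideal.mem_span_singleton_self x), zero_smul]
  have _ : IsLocalRing (A ⧸ Ideal.span {x}) :=
    have : Nontrivial (A ⧸ Ideal.span {x}) := Ideal.Quotient.nontrivial_iff.mpr fun h => by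
      rw [Ideal.span_singleton_eq_top] at h
      exact hx h
    IsLocalRing.of_surjective' _ Ideal.Quotient.mk_surjective
  have _ : Module.Finite A N' := Module.Finite.of_surjective g' hg
  have _ : Module.Finite (A ⧸ Ideal.span {x}) N' :=
    Module.Finite.of_restrictScalars_finite A (A ⧸ Ideal.span {x}) N'
  have _ : Module.Free (A ⧸ Ideal.span {x}) N' := Module.free_of_flat_of_isLocalRing
  have hfp : Module.FinitePresentation A N := Module.finitePresentation_of_finite A N
  have hj : x ∈ (⊥ : Ideal A).jacobson := by rwa [IsLocalRing.jacobson_eq_maximalIdeal ⊥ bot_ne_top]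
  -- By `hk`, the target of `g` is N/xN; its freeness over A/x lifts to N because x is N-regular and
  -- lies in the Jacobson radical.
  refine (Module.free_quotSMulTop_iff_free A N hj hreg).mp ?_
  exact Module.Free.of_equiv (((Submodule.quotEquivOfEq _ _ hk.symm).trans
    (g'.quotKerEquivOfSurjective hg)).extendScalarsOfSurjective Ideal.Quotient.mk_surjective).symm

variable {A : Type*} [CommRing A] (p : ℕ) [Fact p.Prime] [CharP A p] (x : A)

/-- The map `A / x → A / x^j`, `a ↦ a^p`, for `j ≤ p`. -/
noncomputable def quotFrob (j : ℕ) (hj : j ≤ p) :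
    A ⧸ Ideal.span {x} →+* A ⧸ Ideal.span {x ^ j} :=
  Ideal.Quotient.lift _ ((Ideal.Quotient.mk _).comp (frobenius A p)) (fun a ha => by
    obtain ⟨b, rfl⟩ := Ideal.mem_span_singleton'.mp ha
    rw [RingHom.comp_apply, Ideal.Quotient.eq_zero_iff_mem, frobenius_def, mul_pow,
      Ideal.mem_span_singleton]
    exact (pow_dvd_pow x hj).mul_left _)

/-- Induction on j along 0 → A/x → A/x^{j+1} → A/x^j → 0, whose first map is multiplication by x^j.
With A/x acting through p-th powers, the left term is the Frobenius twist of A/x, so each extension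
of projectives splits. -/
theorem projective_quotFrob [CharP (A ⧸ Ideal.span {x}) p] (hx : x ∈ nonZeroDivisors A)
    [Module.Projective (A ⧸ Ideal.span {x}) (FrobTwist p 1 (A ⧸ Ideal.span {x}))]
    (j : ℕ) (hj : j ≤ p) :
    letI := (quotFrob p x j hj).toAlgebra
    Module.Projective (A ⧸ Ideal.span {x}) (A ⧸ Ideal.span {x ^ j}) := by
  induction j with
  | zero =>
    let _ := (quotFrob p x 0 hj).toAlgebra
    have : Subsingleton (A ⧸ Ideal.span {x ^ 0}) := by
      rw [Ideal.Quotient.subsingleton_iff, pow_zero, Ideal.span_singleton_one]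
    exact inferInstance
  | succ j ih =>
    let i1 := (quotFrob p x j (by omega)).toAlgebra
    let i2 := (quotFrob p x (j + 1) hj).toAlgebra
    have hP : Module.Projective (A ⧸ Ideal.span {x}) (A ⧸ Ideal.span {x ^ j}) := ih (by omega)
    have hs1 : ∀ a b : A, (Ideal.Quotient.mk (Ideal.span {x}) a) •
        (Ideal.Quotient.mk (Ideal.span {x ^ j}) b) = Ideal.Quotient.mk _ (a ^ p * b) :=
      fun a b => rfl
    have hs2 : ∀ a b : A, (Ideal.Quotient.mk (Ideal.span {x}) a) •
        (Ideal.Quotient.mk (Ideal.span {x ^ (j + 1)}) b) = Ideal.Quotient.mk _ (a ^ p * b) :=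
      fun a b => rfl
    let i0 : (A ⧸ Ideal.span {x}) →ₗ[A] (A ⧸ Ideal.span {x ^ (j + 1)}) :=
      Submodule.mapQ _ _ (LinearMap.mulLeft A (x ^ j)) (by
        intro a ha
        obtain ⟨b, rfl⟩ := Ideal.mem_span_singleton'.mp ha
        rw [Submodule.mem_comap, LinearMap.mulLeft_apply, Ideal.mem_span_singleton]
        exact ⟨b, by ring⟩)
    have hi0 : ∀ a : A, i0 (Ideal.Quotient.mk _ a) = Ideal.Quotient.mk _ (x ^ j * a) :=
      fun a => rfl
    let i : FrobTwist p 1 (A ⧸ Ideal.span {x}) →ₗ[A ⧸ Ideal.span {x}]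
        (A ⧸ Ideal.span {x ^ (j + 1)}) :=
      { toFun := fun t => i0 ((toTwist p 1 _).symm t)
        map_add' := fun s t => by rw [map_add, map_add]
        map_smul' := fun c t => by
          induction t using FrobTwist.ind with
          | h b =>
            obtain ⟨c, rfl⟩ := Ideal.Quotient.mk_surjective c
            obtain ⟨b, rfl⟩ := Ideal.Quotient.mk_surjective b
            rw [FrobTwist.smul_def, RingEquiv.symm_apply_apply, RingEquiv.symm_apply_apply,
              RingHom.id_apply, ← map_pow, ← map_mul, hi0, hi0, hs2, pow_one]
            congr 1
            ring }
    have hle : Ideal.span {x ^ (j + 1)} ≤ Ideal.span {x ^ j} :=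
      Ideal.span_singleton_le_span_singleton.mpr (pow_dvd_pow x (Nat.le_succ j))
    let g : (A ⧸ Ideal.span {x ^ (j + 1)}) →ₗ[A ⧸ Ideal.span {x}] (A ⧸ Ideal.span {x ^ j}) :=
      { toFun := Ideal.Quotient.factor hle
        map_add' := map_add _
        map_smul' := fun c t => by
          obtain ⟨c, rfl⟩ := Ideal.Quotient.mk_surjective c
          obtain ⟨t, rfl⟩ := Ideal.Quotient.mk_surjective t
          rw [hs2, Ideal.Quotient.factor_mk, RingHom.id_apply, Ideal.Quotient.factor_mk, hs1] }
    refine projective_of_exact i g ?_ (Ideal.Quotient.factor_surjective hle) ?_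
    · rw [injective_iff_map_eq_zero]
      intro t ht
      induction t using FrobTwist.ind with
      | h b =>
        obtain ⟨b, rfl⟩ := Ideal.Quotient.mk_surjective b
        have h1 : Ideal.Quotient.mk (Ideal.span {x ^ (j + 1)}) (x ^ j * b) = 0 := ht
        rw [Ideal.Quotient.eq_zero_iff_mem, Ideal.mem_span_singleton] at h1
        obtain ⟨c, hc⟩ := h1
        have h2 : x ^ j * b = x ^ j * (x * c) := by rw [hc]; ring
        have h3 : b = x * c := by
          rwa [mul_cancel_left_mem_nonZeroDivisors (pow_mem hx j)] at h2
        rw [h3, Ideal.Quotient.eq_zero_iff_mem.mpr (Ideal.mem_span_singleton.mpr ⟨c, rfl⟩),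
          map_zero]
    · intro t
      obtain ⟨t, rfl⟩ := Ideal.Quotient.mk_surjective t
      constructor
      · intro h
        have h1 : Ideal.Quotient.mk (Ideal.span {x ^ j}) t = 0 := h
        rw [Ideal.Quotient.eq_zero_iff_mem, Ideal.mem_span_singleton] at h1
        obtain ⟨c, rfl⟩ := h1
        exact ⟨toTwist p 1 _ (Ideal.Quotient.mk _ c), rfl⟩
      · rintro ⟨s, hs⟩
        induction s using FrobTwist.ind with
        | h b =>
          obtain ⟨b, rfl⟩ := Ideal.Quotient.mk_surjective b
          rw [← hs]
          change Ideal.Quotient.mk (Ideal.span {x ^ j}) (x ^ j * b) = 0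
          rw [Ideal.Quotient.eq_zero_iff_mem, Ideal.mem_span_singleton]
          exact ⟨b, rfl⟩

/-- If `x` is a regular element of a local ring `A`, and Frobenius is free on `A / x`, then it
is free on `A`. -/
theorem free_frobTwist_of_quotient [IsLocalRing A] [IsNoetherianRing A]
    [CharP (A ⧸ Ideal.span {x}) p] (hx : x ∈ nonZeroDivisors A)
    (hm : x ∈ IsLocalRing.maximalIdeal A) (hF : (frobenius A p).Finite)
    [Module.Free (A ⧸ Ideal.span {x}) (FrobTwist p 1 (A ⧸ Ideal.span {x}))] :
    Module.Free A (FrobTwist p 1 A) := by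
  have hfin : Module.Finite A (FrobTwist p 1 A) := finite_twist hF 1
  let i1 := (quotFrob p x p le_rfl).toAlgebra
  have hP : Module.Projective (A ⧸ Ideal.span {x}) (A ⧸ Ideal.span {x ^ p}) :=
    projective_quotFrob p x hx p le_rfl
  -- On the twist, x acts as x^p, so reduction modulo x gives A/x^p: this is the case j = p of
  -- `projective_quotFrob`.
  refine free_of_quotient_projective hm ?_
    ((Ideal.Quotient.mk (Ideal.span {x ^ p})).comp
      (toTwist p 1 A).symm.toRingHom).toAddMonoidHom ?_
    (Ideal.Quotient.mk_surjective.comp (toTwist p 1 A).symm.surjective) ?_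
  · intro s t h
    induction s using FrobTwist.ind with
    | h s =>
      induction t using FrobTwist.ind with
      | h t =>
        simp only [FrobTwist.smul_def] at h
        rw [(toTwist p 1 A).injective.eq_iff,
          mul_cancel_left_mem_nonZeroDivisors (pow_mem hx _)] at h
        rw [h]
  · intro a t
    induction t using FrobTwist.ind with
    | h t =>
      rw [FrobTwist.smul_def, pow_one]
      rfl
  · intro t ht
    induction t using FrobTwist.ind with
    | h t =>
      have h1 : Ideal.Quotient.mk (Ideal.span {x ^ p}) t = 0 := ht
      rw [Ideal.Quotient.eq_zero_iff_mem, Ideal.mem_span_singleton] at h1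
      obtain ⟨c, rfl⟩ := h1
      exact ⟨toTwist p 1 A c, by rw [FrobTwist.smul_def, pow_one]⟩

end Projective

/-! ### Kunz's theorem for regular F-finite domains -/

section RegularLocal

open IsLocalRing

universe u

/-- A regular local ring of positive dimension has an element of the maximal ideal outside its
square and outside all minimal primes. -/
theorem exists_mem_maximalIdeal_notMem_sq (A : Type u) [CommRing A] [IsRegularLocalRing A]
    (h : ringKrullDim A ≠ 0) :
    ∃ x ∈ maximalIdeal A, x ∉ maximalIdeal A ^ 2 ∧ ∀ Q ∈ minimalPrimes A, x ∉ Q := by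
  by_contra! hcon
  have hbot : maximalIdeal A ≠ ⊥ := fun h0 => h (by
    rw [← (isRegularLocalRing_iff A).mp inferInstance, h0, Submodule.spanFinrank_bot]; rfl)
  -- The index `none` carries 𝔪², the only possibly non-prime member of the cover; prime avoidance
  -- tolerates it.
  let g : Option (minimalPrimes A) → Ideal A := fun o => o.elim (maximalIdeal A ^ 2) (fun Q => Q.1)
  have _ : Finite (minimalPrimes A) := (minimalPrimes.finite_of_isNoetherianRing A).to_subtype
  have hsub : (maximalIdeal A : Set A) ⊆ ⋃ i ∈ (Set.univ : Set (Option (minimalPrimes A))), g i := by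
    intro x hx
    rw [Set.mem_iUnion₂]
    by_cases hx2 : x ∈ maximalIdeal A ^ 2
    · exact ⟨none, trivial, hx2⟩
    · obtain ⟨Q, hQ, hxQ⟩ := hcon x hx hx2
      exact ⟨some ⟨Q, hQ⟩, trivial, hxQ⟩
  obtain ⟨i, -, hi⟩ := (Ideal.subset_union_prime_finite Set.finite_univ none none (by
    rintro (_ | ⟨Q, hQ⟩) - h1 -
    · exact absurd rfl h1
    · exact hQ.1.1)).mp hsub
  match i, hi with
  -- 𝔪 ⊆ 𝔪² forces 𝔪 = 0 by Nakayama; in the other case 𝔪 is a minimal prime. Either way the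
  -- dimension is 0.
  | none, hi =>
    refine hbot (Submodule.eq_bot_of_le_smul_of_le_jacobson_bot (maximalIdeal A) _
      (IsNoetherian.noetherian _) ?_ (IsLocalRing.maximalIdeal_le_jacobson ⊥))
    rwa [smul_eq_mul, ← pow_two]
  | some ⟨Q, hQ⟩, hi =>
    have hQp : Q.IsPrime := hQ.1.1
    have hQm : Q = maximalIdeal A := le_antisymm (le_maximalIdeal hQp.ne_top) hi
    apply h
    rw [← maximalIdeal_height_eq_ringKrullDim, ← hQm, Ideal.height_eq_zero_iff.mpr hQ]
    rfl

/-- Write x as a combination of minimal generators of 𝔪. As x ∉ 𝔪², some coefficient is a unit, and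
the corresponding generator is redundant modulo x. -/
theorem spanFinrank_maximalIdeal_quotient_lt (A : Type u) [CommRing A] [IsLocalRing A]
    [IsNoetherianRing A] {x : A} (hx : x ∈ maximalIdeal A) (hx2 : x ∉ maximalIdeal A ^ 2)
    [IsLocalRing (A ⧸ Ideal.span {x})] :
    (maximalIdeal (A ⧸ Ideal.span {x})).spanFinrank + 1 ≤ (maximalIdeal A).spanFinrank := by
  classical
  obtain ⟨s, hcard, hs⟩ :=
    (IsNoetherian.noetherian (maximalIdeal A)).exists_span_finset_card_eq_spanFinrank
  have hx' := hx
  rw [← hs, Submodule.mem_span_finset] at hx'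
  obtain ⟨a, -, ha⟩ := hx'
  have hex : ∃ y ∈ s, IsUnit (a y) := by
    by_contra! hcon
    apply hx2
    rw [← ha, pow_two]
    refine Ideal.sum_mem _ fun y hy => Ideal.mul_mem_mul ((mem_maximalIdeal _).mpr (hcon y hy)) ?_
    rw [← hs]
    exact Submodule.subset_span hy
  obtain ⟨y, hy, hu⟩ := hex
  let π := Ideal.Quotient.mk (Ideal.span {x})
  have hmap : maximalIdeal (A ⧸ Ideal.span {x}) = Ideal.map π (maximalIdeal A) :=
    (map_maximalIdeal_of_surjective π Ideal.Quotient.mk_surjective).symm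
  have hspan : maximalIdeal (A ⧸ Ideal.span {x}) = Ideal.span ((s.erase y).image π : Set _) := by
    rw [hmap, ← hs]
    apply le_antisymm
    · rw [← Ideal.span, Ideal.map_span, Ideal.span_le]
      rintro _ ⟨z, hz, rfl⟩
      by_cases hzy : z = y
      · subst hzy
        have h1 : π (a z) * π z = - ∑ w ∈ s.erase z, π (a w) * π w := by
          have h2 : π x = 0 := Ideal.Quotient.eq_zero_iff_mem.mpr (Ideal.mem_span_singleton_self x)
          rw [congrArg π ha.symm, map_sum, ← Finset.add_sum_erase _ _ hy] at h2
          simp only [smul_eq_mul, map_mul] at h2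
          exact eq_neg_of_add_eq_zero_left h2
        rw [SetLike.mem_coe, ← Ideal.unit_mul_mem_iff_mem _ (hu.map π), h1]
        refine neg_mem (sum_mem fun w hw => Ideal.mul_mem_left _ _ (Ideal.subset_span ?_))
        exact Finset.mem_coe.mpr (Finset.mem_image_of_mem _ hw)
      · exact Ideal.subset_span (Finset.mem_coe.mpr
          (Finset.mem_image_of_mem _ (Finset.mem_erase.mpr ⟨hzy, hz⟩)))
    · rw [Ideal.span_le]
      intro z hz
      obtain ⟨w, hw, rfl⟩ := Finset.mem_image.mp (Finset.mem_coe.mp hz)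
      exact Ideal.mem_map_of_mem _ (Submodule.subset_span (Finset.mem_of_mem_erase hw))
  have h1 : (maximalIdeal (A ⧸ Ideal.span {x})).spanFinrank ≤ (s.erase y).card := by
    rw [hspan]
    refine (Submodule.spanFinrank_span_le_ncard_of_finite (Finset.finite_toSet _)).trans ?_
    rw [Set.ncard_coe_finset]
    exact Finset.card_image_le
  have h2 := Finset.card_erase_add_one hy
  omega

theorem exists_ringKrullDim_eq_natCast (A : Type u) [CommRing A] [FiniteRingKrullDim A] :
    ∃ n : ℕ, ringKrullDim A = n := by
  obtain ⟨m, hm⟩ := WithBot.ne_bot_iff_exists.mp (ringKrullDim_ne_bot (R := A))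
  have hm' : m ≠ ⊤ := fun h => ringKrullDim_ne_top (R := A) (by rw [← hm, h]; rfl)
  obtain ⟨n, hn⟩ := ENat.ne_top_iff_exists.mp hm'
  exact ⟨n, by rw [← hm, ← hn]; rfl⟩

/-- Passing to A/x lowers the dimension by at most one and the embedding dimension by at least one.
These agree for A, and the dimension never exceeds the embedding dimension, so both inequalities are
equalities. -/
theorem isRegularLocalRing_quotient (A : Type u) [CommRing A] [IsRegularLocalRing A] {x : A}
    (hx : x ∈ maximalIdeal A) (hx2 : x ∉ maximalIdeal A ^ 2) :
    IsRegularLocalRing (A ⧸ Ideal.span {x}) ∧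
      ringKrullDim (A ⧸ Ideal.span {x}) + 1 = ringKrullDim A := by
  have _ : Nontrivial (A ⧸ Ideal.span {x}) := Ideal.Quotient.nontrivial_iff.mpr fun h => by
    rw [Ideal.span_singleton_eq_top] at h
    exact hx h
  have _ : IsLocalRing (A ⧸ Ideal.span {x}) :=
    IsLocalRing.of_surjective' _ Ideal.Quotient.mk_surjective
  have h1 := spanFinrank_maximalIdeal_quotient_lt A hx hx2
  have h2 : ringKrullDim A ≤ ringKrullDim (A ⧸ Ideal.span {x}) + 1 := by
    have := ringKrullDim_le_ringKrullDim_quotient_add_card (R := A) {x} (by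
      rw [IsLocalRing.ringJacobson_eq_maximalIdeal]; simpa using hx)
    rw [Finset.coe_singleton, Finset.card_singleton] at this
    exact_mod_cast this
  have h3 := ringKrullDim_le_spanFinrank_maximalIdeal (R := A ⧸ Ideal.span {x})
  have h4 := (isRegularLocalRing_iff A).mp inferInstance
  rw [← h4] at h2 ⊢
  obtain ⟨n, hn⟩ := exists_ringKrullDim_eq_natCast (A ⧸ Ideal.span {x})
  rw [hn] at h2 h3 ⊢
  norm_cast at h2 h3 ⊢
  refine ⟨IsRegularLocalRing.of_spanFinrank_maximalIdeal_le _ ?_, by omega⟩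
  rw [hn]
  norm_cast
  omega

/-- The prime (x) contains a minimal prime Q. An element ax of Q has a ∈ Q because x ∉ Q, so Q = xQ,
and Nakayama gives Q = 0. -/
theorem isDomain_of_quotient (A : Type u) [CommRing A] [IsLocalRing A] [IsNoetherianRing A] {x : A}
    (hx : x ∈ maximalIdeal A) (hmin : ∀ Q ∈ minimalPrimes A, x ∉ Q)
    [IsDomain (A ⧸ Ideal.span {x})] : IsDomain A := by
  have hp : (Ideal.span {x}).IsPrime := (Ideal.Quotient.isDomain_iff_prime _).mp inferInstance
  obtain ⟨Q, hQ, hle⟩ := Ideal.exists_minimalPrimes_le (bot_le : ⊥ ≤ Ideal.span {x})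
  have hQp : Q.IsPrime := hQ.1.1
  have hQ0 : Q = ⊥ := by
    refine Submodule.eq_bot_of_le_smul_of_le_jacobson_bot (maximalIdeal A) _
      (IsNoetherian.noetherian _) ?_ (IsLocalRing.maximalIdeal_le_jacobson ⊥)
    intro y hy
    obtain ⟨a, rfl⟩ := Ideal.mem_span_singleton'.mp (hle hy)
    rw [mul_comm]
    exact Ideal.mul_mem_mul hx ((hQp.mem_or_mem hy).resolve_right (hmin Q hQ))
  rw [hQ0] at hQp
  exact IsDomain.of_bot_isPrime A

theorem frobenius_finite_of_surjective {A B : Type*} [CommRing A] [CommRing B] (p : ℕ)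
    [Fact p.Prime] [CharP A p] [CharP B p] (π : A →+* B) (hπ : Function.Surjective π)
    (hF : (frobenius A p).Finite) : (frobenius B p).Finite := by
  have h1 : (frobenius B p).comp π = π.comp (frobenius A p) :=
    RingHom.ext fun a => (π.map_frobenius p a).symm
  refine RingHom.Finite.of_comp_finite (f := π) ?_
  rw [h1]
  exact (RingHom.Finite.of_surjective π hπ).comp hF

/-- A regular local ring of characteristic `p` with finite Frobenius is a domain, and its
Frobenius is free. -/
theorem isDomain_and_free_frobTwist (p : ℕ) [Fact p.Prime] (d : ℕ) :
    ∀ (A : Type u) [CommRing A] [IsRegularLocalRing A] [CharP A p], ringKrullDim A = d →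
      (frobenius A p).Finite → IsDomain A ∧ Module.Free A (FrobTwist p 1 A) := by
  induction d with
  | zero =>
    intro A _ _ _ hd hF
    -- Dimension 0 and regularity make A a field, over which every module is free.
    have h0 : maximalIdeal A = ⊥ := by
      have h1 := (isRegularLocalRing_iff A).mp inferInstance
      rw [hd] at h1
      norm_cast at h1
      exact (Submodule.spanFinrank_eq_zero_iff_eq_bot (IsNoetherian.noetherian _)).mp h1
    have hf : IsField A := isField_iff_maximalIdeal_eq.mpr h0
    let _ := hf.toField
    exact ⟨inferInstance, inferInstance⟩
  | succ d ih =>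
    intro A _ _ _ hd hF
    -- Lying outside 𝔪² keeps A/x regular; lying outside the minimal primes lifts the domain
    -- property from A/x to A.
    obtain ⟨x, hx, hx2, hmin⟩ := exists_mem_maximalIdeal_notMem_sq A (by
      rw [hd]; norm_cast)
    obtain ⟨hreg, hdim⟩ := isRegularLocalRing_quotient A hx hx2
    have hchar : CharP (A ⧸ Ideal.span {x}) p := by
      refine ringChar.of_eq (CharP.ringChar_of_prime_eq_zero (Fact.out : p.Prime) ?_)
      rw [← map_natCast (Ideal.Quotient.mk (Ideal.span {x})) p, CharP.cast_eq_zero, map_zero]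
    have hd' : ringKrullDim (A ⧸ Ideal.span {x}) = d := by
      obtain ⟨n, hn⟩ := exists_ringKrullDim_eq_natCast (A ⧸ Ideal.span {x})
      rw [hd, hn] at hdim
      rw [hn]
      norm_cast at hdim ⊢
      omega
    obtain ⟨hdom, hfree⟩ := ih (A ⧸ Ideal.span {x}) hd'
      (frobenius_finite_of_surjective p (Ideal.Quotient.mk _) Ideal.Quotient.mk_surjective hF)
    have hA : IsDomain A := isDomain_of_quotient A hx hmin
    have hx0 : x ≠ 0 := fun h => hx2 (by rw [h]; exact zero_mem _)
    exact ⟨hA, free_frobTwist_of_quotient p x (mem_nonZeroDivisors_of_ne_zero hx0) hx hF⟩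

/-- Frobenius is finite on localizations of rings with finite Frobenius. -/
theorem frobenius_finite_localization {R S : Type*} [CommRing R] [CommRing S] [Algebra R S]
    (M : Submonoid R) [IsLocalization M S] (p : ℕ) [Fact p.Prime] [CharP R p] [CharP S p]
    (hF : (frobenius R p).Finite) : (frobenius S p).Finite := by
  have hp1 : p ≠ 0 := (Fact.out : p.Prime).ne_zero
  have hR : Module.Finite R (FrobTwist p 1 R) := finite_twist hF 1
  obtain ⟨s, hs⟩ := hR
  suffices h : Module.Finite S (FrobTwist p 1 S) by
    have h1 : iterateFrobenius S p 1 = frobenius S p := iterateFrobenius_one S p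
    rw [← h1]
    exact h
  classical
  let ι : FrobTwist p 1 R →+ FrobTwist p 1 S :=
    ((toTwist p 1 S).toRingHom.comp ((algebraMap R S).comp
      (toTwist p 1 R).symm.toRingHom)).toAddMonoidHom
  have hι : ∀ a, ι (toTwist p 1 R a) = toTwist p 1 S (algebraMap R S a) := fun a => rfl
  refine ⟨s.image ι, ?_⟩
  have key : ∀ t : FrobTwist p 1 R, ι t ∈ Submodule.span S (s.image ι : Set (FrobTwist p 1 S)) := by
    intro t
    have ht : t ∈ Submodule.span R (s : Set (FrobTwist p 1 R)) := by rw [hs]; trivial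
    induction ht using Submodule.span_induction with
    | mem x hx => exact Submodule.subset_span (Finset.mem_coe.mpr (Finset.mem_image_of_mem _ hx))
    | zero => rw [map_zero]; exact zero_mem _
    | add x y _ _ hx hy => rw [map_add]; exact add_mem hx hy
    | smul a x _ hx =>
      have h1 : ι (a • x) = algebraMap R S a • ι x := by
        induction x using FrobTwist.ind with
        | h x => rw [FrobTwist.smul_def, hι, hι, FrobTwist.smul_def, map_mul, map_pow]
      rw [h1]
      exact Submodule.smul_mem _ _ hx
  rw [eq_top_iff]
  intro t _
  induction t using FrobTwist.ind with
  | h t =>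
    obtain ⟨a, b, rfl⟩ := IsLocalization.exists_mk'_eq M t
    -- From a/b = (1/b)^p · b^{p-1}a, the images of generators over R also generate over S.
    have h1 : IsLocalization.mk' S a b
        = (IsLocalization.mk' S 1 b) ^ p * algebraMap R S ((b : R) ^ (p - 1) * a) := by
      rw [IsLocalization.mk'_eq_iff_eq_mul, map_mul, map_pow]
      have h2 : IsLocalization.mk' S 1 b * algebraMap R S b = 1 := by
        rw [IsLocalization.mk'_spec, map_one]
      have h3 : p = (p - 1) + 1 := by omega
      calc algebraMap R S a
          = (IsLocalization.mk' S 1 b * algebraMap R S b) ^ ((p - 1) + 1) * algebraMap R S a := by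
            rw [h2, one_pow, one_mul]
        _ = IsLocalization.mk' S 1 b ^ ((p - 1) + 1) *
            (algebraMap R S b ^ (p - 1) * algebraMap R S a) * algebraMap R S b := by ring
        _ = _ := by rw [← h3]
    have h4 : toTwist p 1 S (IsLocalization.mk' S a b)
        = IsLocalization.mk' S 1 b • ι (toTwist p 1 R ((b : R) ^ (p - 1) * a)) := by
      rw [hι, FrobTwist.smul_def, pow_one, ← h1]
    rw [h4]
    exact Submodule.smul_mem _ _ (key _)

theorem localRingHom_frobenius {R : Type*} [CommRing R] (p : ℕ) [Fact p.Prime] [CharP R p]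
    (P : Ideal R) [P.IsPrime] [CharP (Localization.AtPrime P) p]
    (h : P = P.comap (frobenius R p)) :
    Localization.localRingHom P P (frobenius R p) h = frobenius (Localization.AtPrime P) p := by
  refine IsLocalization.ringHom_ext P.primeCompl (RingHom.ext fun a => ?_)
  rw [RingHom.comp_apply, RingHom.comp_apply, Localization.localRingHom_to_map,
    RingHom.map_frobenius]

/-- Frobenius is flat on a regular `F`-finite domain. -/
theorem frobenius_flat {R : Type u} [CommRing R] [IsDomain R] [IsRegularRing R] (p : ℕ)
    [Fact p.Prime] [CharP R p] (hF : (frobenius R p).Finite) : (frobenius R p).Flat := by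
  refine RingHom.Flat.ofLocalizationPrime _ fun P hP => ?_
  have hcomap : P = P.comap (frobenius R p) := by
    ext a
    rw [Ideal.mem_comap, frobenius_def, hP.pow_mem_iff_mem _ (Fact.out : p.Prime).pos]
  -- The source of the local map is the localization at the contraction of P, equal to P only
  -- propositionally. Generalizing to Q allows substitution.
  have gen : ∀ (Q : Ideal R) [Q.IsPrime] (h : Q = P.comap (frobenius R p)),
      (Localization.localRingHom Q P (frobenius R p) h).Flat := by
    intro Q hQ h
    obtain rfl : Q = P := h.trans hcomap.symm
    have hchar : CharP (Localization.AtPrime Q) p :=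
      charP_of_injective_algebraMap
        (IsLocalization.injective (Localization.AtPrime Q) Q.primeCompl_le_nonZeroDivisors) p
    rw [localRingHom_frobenius]
    have hfin := frobenius_finite_localization (S := Localization.AtPrime Q) Q.primeCompl p hF
    obtain ⟨d, hd⟩ := exists_ringKrullDim_eq_natCast (Localization.AtPrime Q)
    obtain ⟨-, hfree⟩ := isDomain_and_free_frobTwist p d (Localization.AtPrime Q) hd hfin
    rw [← iterateFrobenius_one]
    exact (inferInstance : Module.Flat (Localization.AtPrime Q)
      (FrobTwist p 1 (Localization.AtPrime Q)))
  exact gen _ rfl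

variable {R : Type u} [CommRing R] [IsDomain R] [IsRegularRing R] (p : ℕ) [Fact p.Prime] [CharP R p]

theorem projective_frobTwist (hF : (frobenius R p).Finite) (k : ℕ) :
    Module.Projective R (FrobTwist p k R) := by
  have hflat : (iterateFrobenius R p k).Flat := by
    induction k with
    | zero => rw [iterateFrobenius_zero]; exact RingHom.Flat.id R
    | succ k ih =>
      have : iterateFrobenius R p (k + 1) = (frobenius R p).comp (iterateFrobenius R p k) := by
        ext x
        simp [iterateFrobenius_def, frobenius_def, pow_succ, pow_mul]
      rw [this]
      exact ih.comp (frobenius_flat p hF)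
  have h1 : Module.Flat R (FrobTwist p k R) := hflat
  have h2 : Module.Finite R (FrobTwist p k R) := finite_twist hF k
  have h3 : Module.FinitePresentation R (FrobTwist p k R) := Module.finitePresentation_of_finite _ _
  exact Module.Flat.projective_of_finitePresentation

/-- Contraction along Frobenius fixes every prime, since a^{p^k} ∈ P iff a ∈ P; so the map on
spectra is surjective. -/
theorem faithfullyFlat_frobTwist (hF : (frobenius R p).Finite) (k : ℕ) :
    Module.FaithfullyFlat R (FrobTwist p k R) := by
  have h1 := projective_frobTwist p hF k
  refine Module.FaithfullyFlat.of_comap_surjective fun P => ⟨⟨P.asIdeal.comap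
    (toTwist p k R).symm.toRingHom, inferInstance⟩, ?_⟩
  ext a
  have hP := P.2
  change a ^ p ^ k ∈ P.asIdeal ↔ _
  rw [hP.pow_mem_iff_mem _ (pow_pos (Fact.out : p.Prime).pos k)]

end RegularLocal

/-! ### Frobenius powers, Frobenius roots and orbits under D_R^k -/

section FrobeniusPowers

universe u

theorem frobPower_le_pow {R : Type u} [CommRing R] (p k : ℕ) (J : Ideal R) :
    frobPower p k J ≤ J ^ p ^ k := by
  rw [frobPower, Ideal.span_le]
  rintro _ ⟨u, hu, rfl⟩
  exact Ideal.pow_mem_pow hu _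

variable {R : Type u} [CommRing R] (p : ℕ) [Fact p.Prime] [CharP R p]

theorem frobPower_eq_map (k : ℕ) (J : Ideal R) :
    frobPower p k J = J.map (iterateFrobenius R p k) := rfl

theorem frobPower_mono (k : ℕ) {I J : Ideal R} (h : I ≤ J) : frobPower p k I ≤ frobPower p k J := by
  rw [frobPower_eq_map, frobPower_eq_map]
  exact Ideal.map_mono h

theorem frobPower_add (k l : ℕ) (J : Ideal R) :
    frobPower p (k + l) J = frobPower p l (frobPower p k J) := by
  rw [frobPower_eq_map, frobPower_eq_map, frobPower_eq_map, Ideal.map_map]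
  congr 1
  ext a
  simp [iterateFrobenius_def, pow_add, pow_mul]

theorem frobPower_mul (k : ℕ) (I J : Ideal R) :
    frobPower p k (I * J) = frobPower p k I * frobPower p k J := by
  rw [frobPower_eq_map, frobPower_eq_map, frobPower_eq_map, Ideal.map_mul]

theorem frobPower_span_singleton (k : ℕ) (c : R) :
    frobPower p k (Ideal.span {c}) = Ideal.span {c ^ p ^ k} := by
  rw [frobPower_eq_map, Ideal.map_span, Set.image_singleton, iterateFrobenius_def]

/-- Viewing J^{[p^k]} as J·R^k makes its behaviour under R-linear maps out of R^k evident. -/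
theorem mem_frobPower_iff (k : ℕ) (J : Ideal R) (a : R) :
    a ∈ frobPower p k J ↔ toTwist p k R a ∈ J • (⊤ : Submodule R (FrobTwist p k R)) := by
  rw [Ideal.smul_top_eq_map]
  rfl

theorem map_mem_of_mem_frobPower {k : ℕ} {J : Ideal R} {a : R} (ha : a ∈ frobPower p k J)
    (φ : FrobTwist p k R →ₗ[R] R) : φ (toTwist p k R a) ∈ J := by
  rw [mem_frobPower_iff] at ha
  have h1 := Submodule.mem_map_of_mem (f := φ) ha
  rw [Submodule.map_smul''] at h1
  exact Ideal.mul_le_left (J := Submodule.map φ ⊤) h1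

theorem diffOpsLevel_apply_mem_frobPower {k : ℕ} {J : Ideal R} {a : R}
    (ha : a ∈ frobPower p k J) (P : diffOpsLevel R p k) : P.1 a ∈ frobPower p k J := by
  rw [mem_frobPower_iff] at ha ⊢
  have h1 := Submodule.mem_map_of_mem (f := diffOpsLevel.toLin P) ha
  rw [Submodule.map_smul''] at h1
  exact Submodule.smul_mono le_rfl le_top h1

variable [IsDomain R] [IsRegularRing R] {p}

theorem frobPower_le_frobPower_iff (hF : (frobenius R p).Finite) (k : ℕ) {I J : Ideal R} :
    frobPower p k I ≤ frobPower p k J ↔ I ≤ J := by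
  refine ⟨fun h => ?_, frobPower_mono p k⟩
  have hff := faithfullyFlat_frobTwist p hF k
  have h1 : I.map (algebraMap R (FrobTwist p k R)) ≤ J.map (algebraMap R (FrobTwist p k R)) := h
  rw [← Ideal.comap_map_eq_self_of_faithfullyFlat (B := FrobTwist p k R) J]
  exact Ideal.le_comap_of_map_le h1

/-- The dual basis lemma for `R^k`. -/
theorem mem_frobPower_of_forall (hF : (frobenius R p).Finite) (k : ℕ) {J : Ideal R} {a : R}
    (h : ∀ φ : FrobTwist p k R →ₗ[R] R, φ (toTwist p k R a) ∈ J) : a ∈ frobPower p k J := by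
  have hP := projective_frobTwist p hF k
  obtain ⟨s, hs⟩ := Module.projective_def'.mp hP
  rw [mem_frobPower_iff]
  have h1 := LinearMap.congr_fun hs (toTwist p k R a)
  rw [LinearMap.id_apply, LinearMap.comp_apply, Finsupp.linearCombination_apply] at h1
  rw [← h1]
  refine Submodule.sum_mem _ fun i _ => Submodule.smul_mem_smul ?_ trivial
  exact h ((Finsupp.lapply i).comp s)

theorem frobRoot_eq_span (hF : (frobenius R p).Finite) (k : ℕ) (b : Ideal R) :
    frobRoot p k b = Ideal.span {y | ∃ (φ : FrobTwist p k R →ₗ[R] R), ∃ x ∈ b,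
      φ (toTwist p k R x) = y} := by
  apply le_antisymm
  · refine sInf_le fun x hx => mem_frobPower_of_forall hF k fun φ => ?_
    exact Ideal.subset_span ⟨φ, x, hx, rfl⟩
  · refine le_sInf fun J hJ => ?_
    rw [Ideal.span_le]
    rintro _ ⟨φ, x, hx, rfl⟩
    exact map_mem_of_mem_frobPower p (hJ hx) φ

/-- The infimum defining the root is attained: by the dual basis lemma, 𝔟 lies in the Frobenius
power of the ideal of all values φ(x), x ∈ 𝔟. Many identities between roots below follow formally
from this adjunction. -/
theorem frobRoot_le_iff (hF : (frobenius R p).Finite) (k : ℕ) {b J : Ideal R} :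
    frobRoot p k b ≤ J ↔ b ≤ frobPower p k J := by
  refine ⟨fun h => ?_, fun h => sInf_le h⟩
  rw [frobRoot_eq_span hF, Ideal.span_le] at h
  exact fun x hx => mem_frobPower_of_forall hF k fun φ => h ⟨φ, x, hx, rfl⟩

theorem le_frobPower_frobRoot (hF : (frobenius R p).Finite) (k : ℕ) (b : Ideal R) :
    b ≤ frobPower p k (frobRoot p k b) :=
  (frobRoot_le_iff hF k).mp le_rfl

theorem frobRoot_mono (hF : (frobenius R p).Finite) (k : ℕ) {b c : Ideal R} (h : b ≤ c) :
    frobRoot p k b ≤ frobRoot p k c :=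
  (frobRoot_le_iff hF k).mpr (h.trans (le_frobPower_frobRoot hF k c))

theorem frobRoot_frobPower_add (hF : (frobenius R p).Finite) (k l : ℕ) (b : Ideal R) :
    frobRoot p (l + k) (frobPower p k b) = frobRoot p l b :=
  eq_of_forall_ge_iff fun J => by
    rw [frobRoot_le_iff hF, frobRoot_le_iff hF, frobPower_add, frobPower_le_frobPower_iff hF]

theorem frobRoot_add (hF : (frobenius R p).Finite) (k l : ℕ) (b : Ideal R) :
    frobRoot p (k + l) b = frobRoot p k (frobRoot p l b) :=
  eq_of_forall_ge_iff fun J => by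
    rw [frobRoot_le_iff hF, frobRoot_le_iff hF, frobRoot_le_iff hF, frobPower_add]

theorem frobRoot_span_pow_mul (hF : (frobenius R p).Finite) (k : ℕ) (c : R) (b : Ideal R) :
    frobRoot p k (Ideal.span {c ^ p ^ k} * b) = Ideal.span {c} * frobRoot p k b := by
  apply le_antisymm
  · rw [frobRoot_le_iff hF, frobPower_mul, frobPower_span_singleton]
    exact Ideal.mul_mono_right (le_frobPower_frobRoot hF k b)
  · rw [frobRoot_eq_span hF k b, Ideal.span_mul_span', Ideal.span_le]
    rintro _ ⟨y, hy, _, ⟨φ, x, hx, rfl⟩, rfl⟩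
    obtain rfl : y = c := hy
    have h1 : y ^ p ^ k * x ∈ frobPower p k (frobRoot p k (Ideal.span {y ^ p ^ k} * b)) :=
      le_frobPower_frobRoot hF k _ (Ideal.mul_mem_mul (Ideal.mem_span_singleton_self _) hx)
    have h2 := map_mem_of_mem_frobPower p h1 φ
    rwa [← FrobTwist.smul_def, map_smul] at h2

/-- The `D_R^k`-submodule of `R` generated by `h`. -/
theorem exists_diffOpsLevel_apply_eq_iff (hF : (frobenius R p).Finite) (k : ℕ) (g h : R) :
    (∃ P ∈ diffOpsLevel R p k, P h = g) ↔ g ∈ frobPower p k (frobRoot p k (Ideal.span {h})) := by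
  constructor
  · rintro ⟨P, hP, rfl⟩
    exact diffOpsLevel_apply_mem_frobPower p
      (le_frobPower_frobRoot hF k _ (Ideal.mem_span_singleton_self h)) ⟨P, hP⟩
  · intro hg
    -- J consists of the values φ(h) for φ : R^k → R linear; by the dual basis lemma it contains the
    -- root of (h).
    let J : Ideal R := LinearMap.range
      (LinearMap.applyₗ (R := R) (M₂ := R) (toTwist p k R h))
    have hJ : frobRoot p k (Ideal.span {h}) ≤ J := by
      rw [frobRoot_le_iff hF, Ideal.span_singleton_le_iff_mem]
      exact mem_frobPower_of_forall hF k fun φ => ⟨φ, rfl⟩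
    have hl : ∀ a : R, LinearMap.mulLeft ℤ a ∈ diffOpsLevel R p k := fun a c d => by
      simp only [LinearMap.mulLeft_apply]; ring
    -- The orbit D_R^k h is an ideal because D_R^k contains the multiplications.
    let K : Ideal R :=
      { carrier := {g | ∃ P ∈ diffOpsLevel R p k, P h = g}
        add_mem' := by
          rintro _ _ ⟨P, hP, rfl⟩ ⟨Q, hQ, rfl⟩
          exact ⟨P + Q, add_mem hP hQ, rfl⟩
        zero_mem' := ⟨0, zero_mem _, rfl⟩
        smul_mem' := by
          rintro a _ ⟨P, hP, rfl⟩
          exact ⟨LinearMap.mulLeft ℤ a * P, mul_mem (hl a) hP, rfl⟩ }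
    have hK : frobPower p k J ≤ K := by
      rw [frobPower, Ideal.span_le]
      rintro _ ⟨_, ⟨φ, rfl⟩, rfl⟩
      -- Following φ by the k-th Frobenius gives an R^{p^k}-linear endomorphism, which takes h to
      -- the generator φ(h)^{p^k} of J^{[p^k]}.
      let P : Module.End ℤ R := ((iterateFrobenius R p k).toAddMonoidHom.comp
        (φ.toAddMonoidHom.comp (toTwist p k R).toRingHom.toAddMonoidHom)).toIntLinearMap
      have hP : ∀ a, P a = φ (toTwist p k R a) ^ p ^ k := fun a => rfl
      refine ⟨P, fun a b => ?_, rfl⟩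
      rw [hP, hP, ← FrobTwist.smul_def, map_smul, smul_eq_mul, mul_pow]
    exact hK (frobPower_mono p k hJ hg)

end FrobeniusPowers

/-! ### Jumps of decreasing, right-constant families -/

section Jumps

/-- An antitone family which is constant on a right neighbourhood of every `l ≥ 0` jumps in
`(s, t]` if its values at `s` and `t` differ. -/
theorem exists_jump_of_ne {β : Type*} [PartialOrder β] {τ : ℝ → β} (hanti : Antitone τ)
    (hright : ∀ l, 0 ≤ l → ∃ u, l < u ∧ τ u = τ l) {s t : ℝ} (hs : 0 ≤ s) (hst : s ≤ t)
    (hne : τ s ≠ τ t) :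
    ∃ y, s < y ∧ y ≤ t ∧ ∀ l', 0 ≤ l' → l' < y → τ y ≠ τ l' := by
  -- The jump is at sup A. Right constancy prevents τ from still having the value τ s there, while
  -- every smaller argument lies below a point of A.
  let A : Set ℝ := {x | s ≤ x ∧ x ≤ t ∧ τ x = τ s}
  have hsA : s ∈ A := ⟨le_rfl, hst, rfl⟩
  have hbdd : BddAbove A := ⟨t, fun x hx => hx.2.1⟩
  have hsy : s ≤ sSup A := le_csSup hbdd hsA
  have hyt : sSup A ≤ t := csSup_le ⟨s, hsA⟩ fun x hx => hx.2.1
  have hne' : τ (sSup A) ≠ τ s := by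
    intro h
    obtain ⟨u, hu, hτu⟩ := hright (sSup A) (hs.trans hsy)
    rcases le_or_gt u t with hut | hut
    · exact absurd (le_csSup hbdd ⟨hsy.trans hu.le, hut, hτu.trans h⟩) (not_le.mpr hu)
    · refine hne (le_antisymm ?_ (hanti hst))
      rw [← h, ← hτu]
      exact hanti hut.le
  refine ⟨sSup A, lt_of_le_of_ne hsy fun h => hne' (by rw [← h]), hyt, fun l' _ hl'y h => ?_⟩
  obtain ⟨x, hx, hl'x⟩ := exists_lt_of_lt_csSup ⟨s, hsA⟩ hl'y
  refine hne' (le_antisymm (hanti hsy) ?_)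
  rw [← hx.2.2, h]
  exact hanti hl'x.le

/-- If the values along `a` keep changing, each change yields a jump between two terms, hence jumps
arbitrarily close to α from below. If they are constant from `a m` on, monotonicity makes τ constant
on [a m, α), and right constancy excludes jumps just above α. -/
theorem not_accPt_jumps_iff {β : Type*} [PartialOrder β] {τ : ℝ → β} (hanti : Antitone τ)
    (hright : ∀ l, 0 ≤ l → ∃ u, l < u ∧ τ u = τ l) {a : ℕ → ℝ} {α : ℝ} (ha : StrictMono a)
    (ha0 : 0 ≤ a 0) (hlim : Tendsto a atTop (𝓝 α)) :
    ¬ AccPt α (𝓟 {l : ℝ | l = 0 ∨ (0 < l ∧ ∀ l' : ℝ, 0 ≤ l' → l' < l → τ l ≠ τ l')}) ↔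
      ∃ m, ∀ n, m ≤ n → τ (a n) = τ (a m) := by
  have hpos : ∀ n, 0 ≤ a n := fun n => ha0.trans (ha.monotone (Nat.zero_le n))
  have hlt : ∀ n, a n < α := fun n =>
    (ha (Nat.lt_succ_self n)).trans_le (ha.monotone.ge_of_tendsto hlim _)
  rw [accPt_iff_nhds]
  constructor
  · contrapose!
    intro h U hU
    obtain ⟨l, hl, hlU⟩ := exists_Ioc_subset_of_mem_nhds hU ⟨α - 1, by simp⟩
    obtain ⟨m, hm⟩ := (hlim.eventually (lt_mem_nhds hl)).exists
    obtain ⟨n, hmn, hne⟩ := h m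
    obtain ⟨y, hy1, hy2, hy⟩ := exists_jump_of_ne hanti hright (hpos m) (ha.monotone hmn) hne.symm
    have hyα : y < α := hy2.trans_lt (hlt n)
    exact ⟨y, ⟨hlU ⟨hm.trans hy1, hyα.le⟩, Or.inr ⟨(hpos m).trans_lt hy1, hy⟩⟩, hyα.ne⟩
  · rintro ⟨m, hm⟩ h
    obtain ⟨u, hu, hτu⟩ := hright α ((hpos 0).trans (hlt 0).le)
    obtain ⟨y, ⟨⟨hy1, hy2⟩, hyS⟩, hyα⟩ := h (Set.Ioo (a m) u) (Ioo_mem_nhds (hlt m) hu)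
    rcases hyS with rfl | ⟨-, hy⟩
    · exact absurd hy1 (not_lt.mpr (hpos m))
    rcases lt_or_gt_of_ne hyα with hlt' | hgt
    · obtain ⟨n, hn, hmn⟩ :=
        ((hlim.eventually (lt_mem_nhds hlt')).and (eventually_ge_atTop m)).exists
      refine hy (a m) (hpos m) hy1 (le_antisymm (hanti hy1.le) ?_)
      rw [← hm n hmn]
      exact hanti hn.le
    · refine hy α ((hpos 0).trans (hlt 0).le) hgt (le_antisymm (hanti hgt.le) ?_)
      rw [← hτu]
      exact hanti hy2.le

end Jumps

/-! ### Test ideals of principal ideals and their right constancy -/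

section TestIdealLemmas

universe u
variable {R : Type u} [CommRing R] [IsDomain R] [IsRegularRing R] {p : ℕ} [Fact p.Prime]
  [CharP R p]

theorem frobRoot_pow_antitone (hF : (frobenius R p).Finite) (k : ℕ) (f : R) {m n : ℕ}
    (h : m ≤ n) : frobRoot p k (Ideal.span {f} ^ n) ≤ frobRoot p k (Ideal.span {f} ^ m) :=
  frobRoot_mono hF k (Ideal.pow_le_pow_right h)

theorem frobRoot_pow_mul_pow (hF : (frobenius R p).Finite) (k l n : ℕ) (f : R) :
    frobRoot p (k + l) (Ideal.span {f} ^ (n * p ^ l)) = frobRoot p k (Ideal.span {f} ^ n) := by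
  rw [← frobRoot_frobPower_add hF l k, Ideal.span_singleton_pow, Ideal.span_singleton_pow,
    frobPower_span_singleton, pow_mul]

theorem frobRoot_pow_add (hF : (frobenius R p).Finite) (k n m : ℕ) (f : R) :
    frobRoot p k (Ideal.span {f} ^ (n * p ^ k + m))
      = Ideal.span {f ^ n} * frobRoot p k (Ideal.span {f} ^ m) := by
  rw [← frobRoot_span_pow_mul hF, pow_add, Ideal.span_singleton_pow f (n * _), pow_mul]

theorem monotone_frobRoot_ceil (hF : (frobenius R p).Finite) (f : R) (l : ℝ) :
    Monotone fun k : ℕ => frobRoot p k (Ideal.span {f} ^ ⌈l * (p : ℝ) ^ k⌉₊) := by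
  refine monotone_nat_of_le_succ fun k => ?_
  rw [← frobRoot_pow_mul_pow hF k 1]
  refine frobRoot_pow_antitone hF _ f (Nat.ceil_le.mpr ?_)
  push_cast
  rw [pow_one, pow_succ, ← mul_assoc]
  exact mul_le_mul_of_nonneg_right (Nat.le_ceil _) (Nat.cast_nonneg _)

theorem exists_testIdeal_eq (hF : (frobenius R p).Finite) (f : R) (l : ℝ) :
    ∃ k, testIdeal p (Ideal.span {f}) l = frobRoot p k (Ideal.span {f} ^ ⌈l * (p : ℝ) ^ k⌉₊) := by
  have h := WellFoundedGT.iSup_eq_monotonicSequenceLimit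
    (⟨_, monotone_frobRoot_ceil hF f l⟩ : ℕ →o Ideal R)
  exact ⟨_, h⟩

/-- For an exponent n/p^k the ceilings are exact from level k on, so the chain is already constant
there. -/
theorem testIdeal_div_pow (hF : (frobenius R p).Finite) (f : R) (n k : ℕ) :
    testIdeal p (Ideal.span {f}) ((n : ℝ) / (p : ℝ) ^ k) = frobRoot p k (Ideal.span {f} ^ n) := by
  have hp : (p : ℝ) ≠ 0 := Nat.cast_ne_zero.mpr (Fact.out : p.Prime).ne_zero
  have h : ∀ j, frobRoot p (k + j) (Ideal.span {f} ^ ⌈(n : ℝ) / (p : ℝ) ^ k * (p : ℝ) ^ (k + j)⌉₊)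
      = frobRoot p k (Ideal.span {f} ^ n) := fun j => by
    have h1 : (n : ℝ) / (p : ℝ) ^ k * (p : ℝ) ^ (k + j) = ((n * p ^ j : ℕ) : ℝ) := by
      rw [pow_add]
      push_cast
      field_simp
    rw [h1, Nat.ceil_natCast, frobRoot_pow_mul_pow hF]
  apply le_antisymm
  · refine iSup_le fun j => ?_
    rw [← h j]
    exact monotone_frobRoot_ceil hF f _ (Nat.le_add_left j k)
  · rw [← h 0]
    exact le_iSup (fun j : ℕ => frobRoot p j
      (Ideal.span {f} ^ ⌈(n : ℝ) / (p : ℝ) ^ k * (p : ℝ) ^ j⌉₊)) (k + 0)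

theorem testIdeal_antitone (hF : (frobenius R p).Finite) (f : R) :
    Antitone fun l : ℝ => testIdeal p (Ideal.span {f}) l := fun l l' h =>
  iSup_mono fun k => frobRoot_pow_antitone hF k f
    (Nat.ceil_le_ceil (mul_le_mul_of_nonneg_right h (by positivity)))

/-- The roots (f)^{[1/p^k]} increase to a stable ideal I, and f ∈ I^{[p^k]} ⊆ I^{p^k} for all large
k. If I were proper, Krull's intersection theorem would give f = 0. -/
theorem exists_frobRoot_eq_top (hF : (frobenius R p).Finite) {f : R} (hf : f ≠ 0) :
    ∃ k, frobRoot p k (Ideal.span {f}) = ⊤ := by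
  have hp1 : 1 < p := (Fact.out : p.Prime).one_lt
  have hmono : Monotone fun k : ℕ => frobRoot p k (Ideal.span {f}) := by
    refine monotone_nat_of_le_succ fun k => ?_
    have h1 := frobRoot_pow_mul_pow hF k 1 1 f
    rw [pow_one (Ideal.span {f})] at h1
    rw [← h1]
    refine frobRoot_mono hF _ (Ideal.pow_le_self ?_)
    rw [one_mul, pow_one]
    omega
  obtain ⟨k, hk⟩ := monotone_stabilizes_iff_noetherian.mpr (inferInstance : IsNoetherian R R)
    (⟨_, hmono⟩ : ℕ →o Ideal R)
  refine ⟨k, by_contra fun hne => hf ?_⟩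
  have hbot := Ideal.iInf_pow_eq_bot_of_isDomain (frobRoot p k (Ideal.span {f})) hne
  rw [← Submodule.mem_bot R, ← hbot, Submodule.mem_iInf]
  intro n
  have h1 : frobRoot p k (Ideal.span {f}) = frobRoot p (max k n) (Ideal.span {f}) :=
    hk _ (le_max_left k n)
  have h2 : n ≤ p ^ max k n := (le_max_right k n).trans (Nat.lt_pow_self hp1).le
  rw [h1]
  exact Ideal.pow_le_pow_right h2 (frobPower_le_pow p _ _
    (le_frobPower_frobRoot hF _ _ (Ideal.mem_span_singleton_self f)))

theorem exists_gt_testIdeal_eq (hF : (frobenius R p).Finite) {f : R} (hf : f ≠ 0) (l : ℝ) :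
    ∃ u, l < u ∧ testIdeal p (Ideal.span {f}) u = testIdeal p (Ideal.span {f}) l := by
  have hp : (0 : ℝ) < p := Nat.cast_pos.mpr (Fact.out : p.Prime).pos
  obtain ⟨k, hk⟩ := exists_testIdeal_eq hF f l
  obtain ⟨j, hj⟩ := exists_frobRoot_eq_top hF hf
  set n := ⌈l * (p : ℝ) ^ k⌉₊
  -- With n = ⌈l p^k⌉ and (f)^{[1/p^j]} = R, the level-j root of f^{n p^j + 1} is f^n · R, so the
  -- additional 1/p^{k+j} leaves the test ideal unchanged.
  refine ⟨((n * p ^ j + 1 : ℕ) : ℝ) / (p : ℝ) ^ (k + j), ?_, ?_⟩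
  · have h1 : l * (p : ℝ) ^ k ≤ n := Nat.le_ceil _
    rw [lt_div_iff₀ (by positivity)]
    push_cast
    calc l * (p : ℝ) ^ (k + j) = l * (p : ℝ) ^ k * (p : ℝ) ^ j := by ring
      _ ≤ n * (p : ℝ) ^ j := mul_le_mul_of_nonneg_right h1 (by positivity)
      _ < _ := lt_add_one _
  · rw [testIdeal_div_pow hF, hk, frobRoot_add hF, frobRoot_pow_add hF, pow_one, hj, Ideal.mul_top,
      Ideal.span_singleton_pow]

end TestIdealLemmas

/-! ### The sequence α_m and its test ideals -/

section AlphaSeq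

/-- The integer `r (1 + q + ⋯ + q^{m-1})`. -/
def geomCoeff (q r : ℕ) : ℕ → ℕ
  | 0 => 0
  | m + 1 => geomCoeff q r m * q + r

theorem geomCoeff_add (q r s t : ℕ) :
    geomCoeff q r (s + t) = geomCoeff q r s * q ^ t + geomCoeff q r t := by
  induction t with
  | zero => simp [geomCoeff]
  | succ t ih =>
    rw [← add_assoc, geomCoeff, ih, geomCoeff]
    ring

theorem le_geomCoeff {q r : ℕ} (hq : 0 < q) (hr : 0 < r) (m : ℕ) : m ≤ geomCoeff q r m := by
  induction m with
  | zero => exact Nat.zero_le _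
  | succ m ih =>
    rw [geomCoeff]
    have := Nat.le_mul_of_pos_right (geomCoeff q r m) hq
    omega

variable (p e r : ℕ) [Fact p.Prime]

theorem alphaSeq_eq_sub (m : ℕ) :
    alphaSeq p e r m
      = (r : ℝ) / ((p : ℝ) ^ e - 1) - (r : ℝ) / ((p : ℝ) ^ e - 1) * (((p : ℝ) ^ e)⁻¹) ^ m := by
  have hp : (p : ℝ) ≠ 0 := Nat.cast_ne_zero.mpr (Fact.out : p.Prime).ne_zero
  rw [alphaSeq, mul_comm m e, pow_mul, inv_pow, sub_div, div_self (by positivity), one_div]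
  ring

variable [NeZero e]

theorem one_lt_cast_pow : (1 : ℝ) < (p : ℝ) ^ e :=
  one_lt_pow₀ (Nat.one_lt_cast.mpr (Fact.out : p.Prime).one_lt) (NeZero.ne e)

theorem alphaSeq_eq_div (m : ℕ) :
    alphaSeq p e r m = (geomCoeff (p ^ e) r m : ℝ) / (p : ℝ) ^ (m * e) := by
  have h1 : (0 : ℝ) < (p : ℝ) ^ e - 1 := sub_pos.mpr (one_lt_cast_pow p e)
  have h2 : (geomCoeff (p ^ e) r m : ℝ) * ((p : ℝ) ^ e - 1) = r * ((p : ℝ) ^ (m * e) - 1) := by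
    rw [mul_comm m e, pow_mul]
    induction m with
    | zero => simp [geomCoeff]
    | succ m ih =>
      rw [geomCoeff]
      push_cast
      rw [add_mul, mul_right_comm, ih]
      ring
  rw [alphaSeq, ← mul_div_assoc, div_mul_eq_mul_div, div_eq_iff h1.ne', div_mul_eq_mul_div, h2,
    mul_comm]

variable {r}

theorem strictMono_alphaSeq (hr : 0 < r) : StrictMono (alphaSeq p e r) := by
  intro m n h
  have h1 := one_lt_cast_pow p e
  have h2 : (0 : ℝ) < (r : ℝ) / ((p : ℝ) ^ e - 1) :=
    div_pos (Nat.cast_pos.mpr hr) (sub_pos.mpr h1)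
  rw [alphaSeq_eq_sub, alphaSeq_eq_sub]
  refine sub_lt_sub_left (mul_lt_mul_of_pos_left ?_ h2) _
  exact pow_lt_pow_right_of_lt_one₀ (by positivity) (inv_lt_one_of_one_lt₀ h1) h

theorem tendsto_alphaSeq :
    Tendsto (alphaSeq p e r) atTop (𝓝 ((r : ℝ) / ((p : ℝ) ^ e - 1))) := by
  have h1 := one_lt_cast_pow p e
  rw [funext (alphaSeq_eq_sub p e r)]
  have h2 := (tendsto_pow_atTop_nhds_zero_of_lt_one (r := ((p : ℝ) ^ e)⁻¹) (by positivity)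
    (inv_lt_one_of_one_lt₀ h1)).const_mul ((r : ℝ) / ((p : ℝ) ^ e - 1))
  simpa using h2.const_sub ((r : ℝ) / ((p : ℝ) ^ e - 1))

universe u
variable {R : Type u} [CommRing R] [IsDomain R] [IsRegularRing R] [CharP R p]
variable {p e}

theorem testIdeal_alphaSeq (hF : (frobenius R p).Finite) (f : R) (m : ℕ) :
    testIdeal p (Ideal.span {f}) (alphaSeq p e r m)
      = frobRoot p (m * e) (Ideal.span {f} ^ geomCoeff (p ^ e) r m) := by
  rw [alphaSeq_eq_div, testIdeal_div_pow hF]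

theorem testIdeal_alphaSeq_succ (hF : (frobenius R p).Finite) (f : R) (m : ℕ) :
    testIdeal p (Ideal.span {f}) (alphaSeq p e r (m + 1)) =
      frobRoot p e (Ideal.span {f ^ r} * testIdeal p (Ideal.span {f}) (alphaSeq p e r m)) := by
  -- The top term r q^m is split off, rather than the bottom r of the definition, so that f^r comes
  -- out of the root at level me before the last root at level e is taken.
  have h1 : geomCoeff (p ^ e) r (m + 1) = r * p ^ (m * e) + geomCoeff (p ^ e) r m := by
    rw [add_comm m 1, geomCoeff_add, mul_comm m e, pow_mul]
    simp [geomCoeff]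
  rw [testIdeal_alphaSeq hF, testIdeal_alphaSeq hF, h1, ← frobRoot_pow_add hF,
    Nat.succ_mul, add_comm (m * e) e, frobRoot_add hF]

/-- Each test ideal in the sequence is a fixed function of the preceding one, so a single repetition
is permanent. -/
theorem testIdeal_alphaSeq_eq_of_le (hF : (frobenius R p).Finite) (f : R) {m : ℕ}
    (h : testIdeal p (Ideal.span {f}) (alphaSeq p e r m)
      = testIdeal p (Ideal.span {f}) (alphaSeq p e r (m + 1))) {n : ℕ} (hn : m ≤ n) :
    testIdeal p (Ideal.span {f}) (alphaSeq p e r n)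
      = testIdeal p (Ideal.span {f}) (alphaSeq p e r m) := by
  induction n, hn using Nat.le_induction with
  | base => rfl
  | succ n _ ih => rw [testIdeal_alphaSeq_succ hF, ih, ← testIdeal_alphaSeq_succ hF, ← h]

theorem not_accPt_isFJumpingExponent_iff (hF : (frobenius R p).Finite) {f : R} (hf : f ≠ 0)
    (hr : 0 < r) :
    ¬ AccPt ((r : ℝ) / ((p : ℝ) ^ e - 1))
        (𝓟 {l : ℝ | IsFJumpingExponent p (Ideal.span {f}) l}) ↔
      ∃ m, testIdeal p (Ideal.span {f}) (alphaSeq p e r m)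
        = testIdeal p (Ideal.span {f}) (alphaSeq p e r (m + 1)) := by
  refine (not_accPt_jumps_iff (testIdeal_antitone hF f)
    (fun l _ => exists_gt_testIdeal_eq hF hf l) (strictMono_alphaSeq p e hr) (by simp [alphaSeq])
    (tendsto_alphaSeq p e)).trans ?_
  exact ⟨fun ⟨m, hm⟩ => ⟨m, (hm (m + 1) (Nat.le_succ m)).symm⟩,
    fun ⟨m, hm⟩ => ⟨m, fun n hn => testIdeal_alphaSeq_eq_of_le hF f hm hn⟩⟩

end AlphaSeq

/-! ### The D_R-orbit of e_α -/

namespace MAlpha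

universe u
variable {R : Type u} [CommRing R] (p e r : ℕ) (f : R)

theorem frac_smul_gen (a : R) (m : ℕ) :
    frac f a m • gen p e r f = a • (frac f 1 m • gen p e r f) := by
  rw [smul_frac, mul_one]

theorem smul_frac_one_injective [IsDomain R] {f : R} (hf : f ≠ 0) (n : ℕ) :
    Function.Injective fun a : R => a • (frac f 1 n • gen p e r f) := by
  intro a b h
  have h1 : frac f a n * 1 = frac f b n * 1 := by
    have h2 : a • (frac f 1 n • gen p e r f) = b • (frac f 1 n • gen p e r f) := h
    rwa [← frac_smul_gen, ← frac_smul_gen] at h2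
  rw [mul_one, mul_one, frac, frac, Localization.mk_eq_mk', IsLocalization.mk'_eq_iff_eq,
    mul_comm, mul_comm _ b] at h1
  have hinj := IsLocalization.injective (Localization.Away f)
    (powers_le_nonZeroDivisors_of_noZeroDivisors hf)
  exact mul_right_cancel₀ (pow_ne_zero n hf) (hinj h1)

variable [Fact p.Prime] [CharP R p]

theorem iter_frob_gen (s : ℕ) :
    ((frob p e r f).iter s).toHom (gen p e r f)
      = frac f 1 (geomCoeff (p ^ e) r s) • gen p e r f := by
  induction s with
  | zero =>
    have h : frac f 1 0 = 1 :=
      (congrArg (Localization.mk 1) (Subtype.ext (pow_zero f))).trans Localization.mk_one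
    rw [geomCoeff, h, one_smul]
    rfl
  | succ s ih =>
    change (frob p e r f).toHom (((frob p e r f).iter s).toHom (gen p e r f)) = _
    rw [ih, frob_frac, one_pow, geomCoeff]

/-- This is f^{-g_s} = f^{g_t q^s} · f^{-g_{t+s}}. It rewrites the target over (F^e)^{t+s}(e_α),
where operators of level (t+s)e act on the coefficient alone. -/
theorem iter_frob_gen_eq_smul (s t : ℕ) :
    ((frob p e r f).iter s).toHom (gen p e r f)
      = f ^ (geomCoeff (p ^ e) r t * (p ^ e) ^ s)
        • ((frob p e r f).iter (t + s)).toHom (gen p e r f) := by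
  rw [iter_frob_gen, iter_frob_gen, geomCoeff_add, ← frac_smul_gen,
    add_comm (geomCoeff (p ^ e) r t * _), ← one_mul (f ^ _), ← frac_eq]

variable [NeZero e]

theorem smul_smul_iter_frob (P : diffOps R) {s : ℕ} (hs : P.1 ∈ diffOpsLevel R p (s * e)) (a : R)
    (u : MAlpha p e r f) :
    P • (a • ((frob p e r f).iter s).toHom u) = P.1 a • ((frob p e r f).iter s).toHom u :=
  FrobAction.act_smul _ _ P hs a u

theorem smul_gen (P : diffOps R) {s : ℕ} (hs : P.1 ∈ diffOpsLevel R p (s * e)) :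
    P • gen p e r f
      = P.1 (f ^ geomCoeff (p ^ e) r s) • ((frob p e r f).iter s).toHom (gen p e r f) := by
  rw [← smul_smul_iter_frob p e r f P hs]
  congr 1
  have h := iter_frob_gen_eq_smul p e r f 0 s
  rw [pow_zero, mul_one, add_zero] at h
  exact h

variable [IsDomain R] [IsRegularRing R] {f} {p}

/-- `F^s(e_α)` lies in `D_R^{(t+s)e} e_α` if and only if `τ(f^{α_t}) ⊆ τ(f^{α_{t+s}})`. -/
theorem exists_smul_gen_eq_iter_frob_iff (hF : (frobenius R p).Finite) (hf : f ≠ 0) (s t : ℕ) :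
    (∃ P : diffOps R, (P : Module.End ℤ R) ∈ diffOpsLevel R p ((t + s) * e) ∧
      P • gen p e r f = ((frob p e r f).iter s).toHom (gen p e r f)) ↔
    testIdeal p (Ideal.span {f}) (alphaSeq p e r t)
      ≤ testIdeal p (Ideal.span {f}) (alphaSeq p e r (t + s)) := by
  have h1 : (∃ P : diffOps R, (P : Module.End ℤ R) ∈ diffOpsLevel R p ((t + s) * e) ∧
      P • gen p e r f = ((frob p e r f).iter s).toHom (gen p e r f)) ↔
      ∃ P ∈ diffOpsLevel R p ((t + s) * e), P (f ^ geomCoeff (p ^ e) r (t + s))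
        = f ^ (geomCoeff (p ^ e) r t * (p ^ e) ^ s) := by
    -- Both sides are multiples of f^{-g_{t+s}} e_α, which is torsion-free, so their coefficients in
    -- R can be compared.
    have key : ∀ P : diffOps R, P.1 ∈ diffOpsLevel R p ((t + s) * e) →
        (P • gen p e r f = ((frob p e r f).iter s).toHom (gen p e r f) ↔
          P.1 (f ^ geomCoeff (p ^ e) r (t + s))
            = f ^ (geomCoeff (p ^ e) r t * (p ^ e) ^ s)) := by
      intro P hP
      rw [smul_gen p e r f P hP, iter_frob_gen_eq_smul p e r f s t, iter_frob_gen]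
      exact (smul_frac_one_injective p e r hf _).eq_iff
    constructor
    · rintro ⟨P, hP, h⟩
      exact ⟨P.1, hP, (key P hP).mp h⟩
    · rintro ⟨P, hP, h⟩
      exact ⟨⟨P, level_le_diffOps hF _ hP⟩, hP, (key ⟨P, level_le_diffOps hF _ hP⟩ hP).mpr h⟩
  -- By adjunction, membership of f^{g_t q^s} in the Frobenius power says that its root at level
  -- (t+s)e, which is τ(f^{α_t}), lies in τ(f^{α_{t+s}}).
  rw [h1, exists_diffOpsLevel_apply_eq_iff hF, testIdeal_alphaSeq hF, testIdeal_alphaSeq hF,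
    ← Ideal.span_singleton_le_iff_mem, ← frobRoot_le_iff hF, ← Ideal.span_singleton_pow,
    ← Ideal.span_singleton_pow, ← pow_mul p e s, Nat.add_mul, mul_comm e s, frobRoot_pow_mul_pow hF]

theorem testIdeal_alphaSeq_succ_eq_iff (hF : (frobenius R p).Finite) (hf : f ≠ 0) (hr : 0 < r)
    (m : ℕ) :
    testIdeal p (Ideal.span {f}) (alphaSeq p e r m)
        = testIdeal p (Ideal.span {f}) (alphaSeq p e r (m + 1)) ↔
      ∃ P : diffOps R, (P : Module.End ℤ R) ∈ diffOpsLevel R p ((m + 1) * e) ∧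
        P • gen p e r f = (frob p e r f).toHom (gen p e r f) := by
  refine Iff.trans ?_ (exists_smul_gen_eq_iter_frob_iff e r hF hf 1 m).symm
  exact ⟨le_of_eq, fun h => le_antisymm h
    (testIdeal_antitone hF f ((strictMono_alphaSeq p e hr).monotone (Nat.le_succ m)))⟩

theorem span_gen_eq_top_iff (hF : (frobenius R p).Finite) (hf : f ≠ 0) (hr : 0 < r) :
    Submodule.span (diffOps R) {gen p e r f} = ⊤ ↔
      ∃ m, testIdeal p (Ideal.span {f}) (alphaSeq p e r m)
        = testIdeal p (Ideal.span {f}) (alphaSeq p e r (m + 1)) := by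
  constructor
  · intro h
    have h1 : (frob p e r f).toHom (gen p e r f) ∈ Submodule.span (diffOps R) {gen p e r f} := by
      rw [h]; trivial
    obtain ⟨P, hP⟩ := Submodule.mem_span_singleton.mp h1
    -- An operator of level k also has level (k+1)e, since e > 0; thus m = k will do.
    obtain ⟨k, hk⟩ := (mem_diffOps_iff hF P.1).mp P.2
    refine ⟨k, (testIdeal_alphaSeq_succ_eq_iff e r hF hf hr k).mpr
      ⟨P, diffOpsLevel_mono p ?_ hk, hP⟩⟩
    exact (Nat.le_succ k).trans (Nat.le_mul_of_pos_right _ (NeZero.pos e))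
  · rintro ⟨m, hm⟩
    rw [eq_top_iff]
    intro x _
    obtain ⟨b, n, rfl⟩ := exists_frac p e r f x
    have hn : n ≤ geomCoeff (p ^ e) r n :=
      le_geomCoeff (pow_pos (Fact.out : p.Prime).pos e) hr n
    -- With g_n = n + d, one has b/f^n = b f^d / f^{g_n}. So first reach (F^e)^n(e_α) by P, then
    -- multiply by b f^d, an operator of level 0.
    obtain ⟨d, hd⟩ := Nat.exists_eq_add_of_le hn
    obtain ⟨P, -, hP⟩ := (exists_smul_gen_eq_iter_frob_iff e r hF hf n m).mpr
      (testIdeal_alphaSeq_eq_of_le hF f hm (Nat.le_add_right m n)).ge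
    have hl : LinearMap.mulLeft ℤ (b * f ^ d) ∈ diffOpsLevel R p (0 * e) := fun c d => by
      simp only [LinearMap.mulLeft_apply]; ring
    let Q : diffOps R := ⟨LinearMap.mulLeft ℤ (b * f ^ d), level_le_diffOps hF _ hl⟩
    have hQ : ∀ u : MAlpha p e r f, Q • u = (b * f ^ d) • u := fun u => by
      have h1 := smul_smul_iter_frob p e r f Q hl 1 u
      have h2 : Q.1 1 = b * f ^ d := mul_one _
      rwa [h2, one_smul] at h1
    refine Submodule.mem_span_singleton.mpr ⟨Q * P, ?_⟩
    rw [mul_smul, hP, hQ, iter_frob_gen, ← frac_smul_gen, hd, ← frac_eq]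

end MAlpha

end FThreshold

theorem mainTheorem4 {R : Type*} [CommRing R] [IsDomain R] [IsRegularRing R]
    (p : ℕ) [Fact p.Prime] [CharP R p] (hF : (frobenius R p).Finite)
    (f : R) (hf : f ≠ 0) (e r : ℕ) [NeZero e] (hr : 0 < r) :
    (Submodule.span (FThreshold.diffOps R) {FThreshold.MAlpha.gen p e r f} = ⊤ ↔
      ¬ AccPt ((r : ℝ) / ((p : ℝ) ^ e - 1))
        (𝓟 {l : ℝ | FThreshold.IsFJumpingExponent p (Ideal.span {f}) l})) ∧
    ∀ m : ℕ,
      (FThreshold.testIdeal p (Ideal.span {f}) (FThreshold.alphaSeq p e r m)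
          = FThreshold.testIdeal p (Ideal.span {f}) (FThreshold.alphaSeq p e r (m + 1)) ↔
        ∃ P : FThreshold.diffOps R,
          (P : Module.End ℤ R) ∈ FThreshold.diffOpsLevel R p ((m + 1) * e) ∧
          P • FThreshold.MAlpha.gen p e r f
            = (FThreshold.MAlpha.frob p e r f).toHom (FThreshold.MAlpha.gen p e r f)) := by
  have hacc := FThreshold.not_accPt_isFJumpingExponent_iff (e := e) hF hf hr
  exact ⟨(FThreshold.MAlpha.span_gen_eq_top_iff e r hF hf hr).trans hacc.symm,
    FThreshold.MAlpha.testIdeal_alphaSeq_succ_eq_iff e r hF hf hr⟩
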